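/- \textbf{Primitives.} There are two firms $1,2$ and two groups $A,B$ of workers. A market consists of $\beta\ge 1$ (the mass of group $A$; group $B$ has mass $1$) and, for each $g\in\{A,B\}$, a Lebesgue measurable probability density $f_g$ on $[0,1]$ (the distribution of productivities) that is bounded away from $0$ and from $\infty$. \textbf{Cooperative game.} An outcome for firm $i$ is a family $O_i=(f_g^i,w_i^g)_{g\in\{A,B\}}$ of measurable functions on $[0,1]$ with $0\le f_g^i\le f_g$, $w_i^g\ge 0$, $w_i^g(v)=0$ whenever $f_g^i(v)=0$, and $w_i^g(v)\ge w_i^g(v')$ whenever $v\ge v'$ and $f_g^i(v)>0$. In addition: (no EPSW) nothing more; (group-based EPSW) there are no group $g$ and sets $V,V'\subset[0,1]$ of positive Lebesgue measure, with the other group denoted $-g$, such that $f_g^i>0$ on $V$, $f_{-g}^i>0$ on $V'$ and $\inf_{V'}w_i^{-g}>\sup_V w_i^g$; (non-group-based EPSW) there is $w_i\in[0,1]$ with $w_i^g(v)=w_i$ for all $g$ and almost all $v$ with $f_g^i(v)>0$. The profit is $$\pi_i^{O_i}=\beta\int_0^1[v-w_i^A(v)]f_A^i(v)\,dv+\int_0^1[v-w_i^B(v)]f_B^i(v)\,dv\in[-\infty,\infty).$$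 An outcome is a pair $O=(O_1,O_2)$ with $f_g^1+f_g^2\le f_g$ for each $g$. Firm $j$ (with rival $-j$) blocks $O$ via an outcome $\tilde O_j$ for $j$ (in the same regime) if $\pi_j^{\tilde O_j}>\pi_j^{O_j}$ and for each $g$ and almost every $v$ at least one of the following holds: (1) $\tilde w_j^g(v)\ge w_j^g(v)$ and $\tilde w_j^g(v)>w_{-j}^g(v)$; (2) $\tilde w_j^g(v)\ge w_j^g(v)$ and $\tilde f_g^j(v)+f_g^{-j}(v)\le f_g(v)$; (3) $\tilde w_j^g(v)>w_{-j}^g(v)$ and $\tilde f_g^j(v)+f_g^j(v)\le f_g(v)$; (4) $\tilde f_g^j(v)+f_g^j(v)+f_g^{-j}(v)\le f_g(v)$. A core outcome is an outcome that no firm blocks via any outcome. \textbf{Non-cooperative game.} Workers are triples $(g,v,\iota)\in\{A,B\}\times[0,1]^2$ with productivity $v$ and index $\iota$. The workers of group $g$ are distributed according to $\mu_g=\mu_g^{\mathrm p}\times\mu_g^{\mathrm w}$, where $\mu^{\mathrm p}_g$ has density $f_g$ on the Lebesgue $\sigma$-algebra of $[0,1]$ and $\mu_g^{\mathrm w}$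 is a non-atomic probability measure on some $\sigma$-algebra on $[0,1]$, the same one for both groups. First, the firms simultaneously announce, for each $g$, a measurable set $S_i^g\subseteq[0,1]^2$ of workers that receive an offer and a measurable wage function $w_i^g:S_i^g\to\mathbb R$ with $w_i^g(v,\iota)\ge w_i^g(v',\iota')$ if $v\ge v'$. Then each worker observes the offers made to her and accepts one of them or stays unassigned; a worker's strategy is a function of her own offers. Her payoff is the accepted wage, or $0$ if she is unassigned. Let $\tilde S_i^g$ be the set of workers of group $g$ who accept firm $i$'s offer. The payoff of firm $i$ is $$\beta\int_{\tilde S_i^A}[v-w_i^A(v,\iota)]\,d\mu_A+\int_{\tilde S_i^B}[v-w_i^B(v,\iota)]\,d\mu_B,$$ except that it is $-1$ if $\tilde S_i^A$ or $\tilde S_i^B$ is not measurable, or if (under group-based EPSW) there are sets $T\subseteq\tilde S_i^g$, $T'\subseteq\tilde S_i^{g'}$ of positive measure with $g\neq g'$ such that every worker of $T$ is paid a wage different from that of every worker of $T'$, or (under non-group-based EPSW) if there are such sets with $g,g'$ arbitrary, possibly equal. A strategy profile is a subgame perfect Nash equilibrium if each worker's decision is optimal after every pair of announcements, and no firm can gain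 by changing its announcement, given the other firm's announcement and the workers' strategies. The outcome associated with a profile is $(f_g^i,w_i^g)$, where $f_g^i(v)=f_g(v)\,\mu_g^{\mathrm w}(\{\iota:(v,\iota)\in\tilde S_i^g\})$ is the density of the workers of type $(g,v)$ hired by firm $i$, and $w_i^g(v)$ is the wage paid to them if $f_g^i(v)>0$ and $0$ otherwise. \textbf{Proposition.} In each of the three regimes (no EPSW, group-based EPSW, non-group-based EPSW), the set of subgame perfect Nash equilibrium outcomes of the non-cooperative game coincides with the core of the cooperative game, outcomes being identified when they agree for almost every $v$. That is, the outcome of every subgame perfect Nash equilibrium is a core outcome, and every core outcome agrees, for almost every $v$, with the outcome of some subgame perfect Nash equilibrium. -/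

import Mathlib

open MeasureTheory Set

noncomputable section

namespace LaborMarket

/-! ## Primitives -/

inductive Firm
  | one
  | two
  deriving DecidableEq

def Firm.other : Firm → Firm
  | .one => .two
  | .two => .one

/-- The two groups of workers. -/
inductive WorkerGroup
  | A
  | B

def WorkerGroup.other : WorkerGroup → WorkerGroup
  | .A => .B
  | .B => .A

/-- The three policy regimes: no equal pay for similar work (EPSW), group-based EPSW, and
non-group-based EPSW. -/
inductive Regime
  | noEPSW
  | groupBased
  | nonGroupBased

/-- Productivities: the interval `[0, 1]`. -/
def Productivity : Type := Set.Icc (0 : ℝ) 1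

/-- The productivity as a real number. -/
def Productivity.val (v : Productivity) : ℝ := Subtype.val v

instance : LinearOrder Productivity := inferInstanceAs (LinearOrder (Set.Icc (0 : ℝ) 1))

/-- `[0, 1]` with the sigma-algebra of Lebesgue measurable sets (the completion of the Borel
sigma-algebra) and Lebesgue measure on it. -/
instance : MeasureSpace Productivity where
  toMeasurableSpace :=
    inferInstanceAs (MeasurableSpace
      (NullMeasurableSpace (Set.Icc (0 : ℝ) 1) (volume : Measure (Set.Icc (0 : ℝ) 1))))
  volume := (volume : Measure (Set.Icc (0 : ℝ) 1)).completion

/-- Indices of workers: the interval `[0, 1]`. No sigma-algebra is fixed here: the index space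
carries an arbitrary sigma-algebra, which is a parameter of the game. -/
def Index : Type := Set.Icc (0 : ℝ) 1

/-- A measure is non-atomic if every measurable set of positive measure contains a measurable
subset of strictly smaller positive measure. (For a general sigma-algebra this is stronger than
all singletons being null.) -/
def NonAtomic {α : Type*} [MeasurableSpace α] (μ : Measure α) : Prop :=
  ∀ s, MeasurableSet s → 0 < μ s → ∃ t, MeasurableSet t ∧ t ⊆ s ∧ 0 < μ t ∧ μ t < μ s

/-- The integral of a real function as an extended real number: the integral of the positive part
minus that of the negative part. It is `-∞` when only the latter is infinite. -/
def extIntegral {α : Type*} [MeasurableSpace α] (μ : Measure α) (h : α → ℝ) : EReal :=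
  ((∫⁻ x, ENNReal.ofReal (h x) ∂μ : ENNReal) : EReal) -
    ((∫⁻ x, ENNReal.ofReal (-h x) ∂μ : ENNReal) : EReal)

/-- A labor market: a mass `β ≥ 1` of `A`-group workers (and a mass `1` of `B`-group workers) and
for each group a productivity distribution with a density on `[0, 1]` bounded away from zero and
from infinity. -/
structure Market where
  β : ℝ
  one_le_β : 1 ≤ β
  f : WorkerGroup → Productivity → ℝ
  measurable_f : ∀ g, Measurable (f g)
  lower : ∀ g, ∃ c : ℝ, 0 < c ∧ ∀ v, c ≤ f g v
  upper : ∀ g, ∃ C : ℝ, ∀ v, f g v ≤ C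
  integral_f : ∀ g, ∫ v, f g v = 1

/-! ## The cooperative game -/

/-- Data of an outcome for one firm: the density `f g v` of the workers of type `(g, v)` that it
hires and the wage `w g v` that it pays to them. -/
@[ext] structure FirmOutcome where
  f : WorkerGroup → Productivity → ℝ
  w : WorkerGroup → Productivity → ℝ

/-- The additional restriction that the regime imposes on an outcome for a firm. -/
def WageRestriction (O : FirmOutcome) : Regime → Prop
  | .noEPSW => True
  | .groupBased =>
      ¬ ∃ (g : WorkerGroup) (V V' : Set Productivity),
        MeasurableSet V ∧ 0 < volume V ∧ MeasurableSet V' ∧ 0 < volume V' ∧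
        (∀ v ∈ V, 0 < O.f g v) ∧ (∀ v ∈ V', 0 < O.f g.other v) ∧
        (⨆ v ∈ V, (O.w g v : EReal)) < ⨅ v ∈ V', (O.w g.other v : EReal)
  | .nonGroupBased =>
      ∃ c ∈ Set.Icc (0 : ℝ) 1, ∀ g, ∀ᵐ v, 0 < O.f g v → O.w g v = c

/-- `O` is an outcome for a firm in the market `M` under the regime `r`. -/
structure IsFirmOutcome (M : Market) (r : Regime) (O : FirmOutcome) : Prop where
  measurable_f : ∀ g, Measurable (O.f g)
  measurable_w : ∀ g, Measurable (O.w g)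
  f_nonneg : ∀ g v, 0 ≤ O.f g v
  f_le : ∀ g v, O.f g v ≤ M.f g v
  w_nonneg : ∀ g v, 0 ≤ O.w g v
  w_eq_zero : ∀ g v, O.f g v = 0 → O.w g v = 0
  monotone : ∀ g v v', v' ≤ v → 0 < O.f g v → O.w g v' ≤ O.w g v
  restriction : WageRestriction O r

/-- The profit of a firm under an outcome for it. -/
def profit (M : Market) (O : FirmOutcome) : EReal :=
  (M.β : EReal) * extIntegral volume (fun v => (v.val - O.w .A v) * O.f .A v) +
    extIntegral volume (fun v => (v.val - O.w .B v) * O.f .B v)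

/-- `O` is an outcome (for both firms): total hiring does not exceed the supply of workers. -/
structure IsOutcome (M : Market) (r : Regime) (O : Firm → FirmOutcome) : Prop where
  firm : ∀ i, IsFirmOutcome M r (O i)
  feasible : ∀ g v, (O .one).f g v + (O .two).f g v ≤ M.f g v

/-- The firm `j` blocks `O` via the alternative outcome `O'` for `j`. -/
def Blocks (M : Market) (r : Regime) (O : Firm → FirmOutcome) (j : Firm) (O' : FirmOutcome) :
    Prop :=
  IsFirmOutcome M r O' ∧ profit M (O j) < profit M O' ∧
    ∀ g, ∀ᵐ v,
      ((O j).w g v ≤ O'.w g v ∧ (O j.other).w g v < O'.w g v) ∨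
      ((O j).w g v ≤ O'.w g v ∧ O'.f g v + (O j.other).f g v ≤ M.f g v) ∨
      ((O j.other).w g v < O'.w g v ∧ O'.f g v + (O j).f g v ≤ M.f g v) ∨
      (O'.f g v + (O j).f g v + (O j.other).f g v ≤ M.f g v)

/-- Core outcomes: outcomes that are not blocked. -/
def IsCoreOutcome (M : Market) (r : Regime) (O : Firm → FirmOutcome) : Prop :=
  IsOutcome M r O ∧ ¬ ∃ j O', Blocks M r O j O'

/-- Two outcomes agree, firm by firm, up to a null set of productivities. -/
def OutcomeAEEq (O O' : Firm → FirmOutcome) : Prop :=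
  ∀ i g, ∀ᵐ v, (O i).f g v = (O' i).f g v ∧ (O i).w g v = (O' i).w g v

/-! ## The non-cooperative game -/

/-- Workers of a given group: pairs of a productivity and an index. -/
abbrev Worker : Type := Productivity × Index

/-- A firm's announcement: for each group `g` a measurable set `S g` of workers to which it makes
offers and a measurable function `w g` on `S g`, the wage offered, non-decreasing in productivity.
The values of `w g` outside `S g` play no role. -/
structure Announcement [MeasurableSpace Index] where
  S : WorkerGroup → Set Worker
  w : WorkerGroup → Worker → ℝ
  measurable_S : ∀ g, MeasurableSet (S g)
  measurable_w : ∀ g, Measurable (fun x : S g => w g x)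
  monotone : ∀ g, ∀ x ∈ S g, ∀ y ∈ S g, y.1 ≤ x.1 → w g y ≤ w g x

/-- What a worker observes: for each firm, the wage it offers to her, if it makes her an offer. -/
abbrev Offers : Type := Firm → Option ℝ

open Classical in
/-- The offers that worker `x` of group `g` receives. -/
def offers [MeasurableSpace Index] (a : Firm → Announcement) (g : WorkerGroup) (x : Worker) :
    Offers :=
  fun i => if x ∈ (a i).S g then some ((a i).w g x) else none

/-- A worker may stay unassigned (`none`) or accept an offer that she has received. -/
def Available (o : Offers) : Option Firm → Prop
  | none => True
  | some i => (o i).isSome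

/-- The worker's payoff: the wage of the offer that she accepts, and zero if unassigned. -/
def workerPayoff (o : Offers) : Option Firm → ℝ
  | none => 0
  | some i => (o i).getD 0

/-- Strategies of all workers: an available decision as a function of the observed offers. -/
structure WorkerStrategies where
  choice : WorkerGroup → Worker → Offers → Option Firm
  available : ∀ g x o, Available o (choice g x o)

/-- The set of workers of group `g` who accept the offer of firm `i`. -/
def hired [MeasurableSpace Index] (a : Firm → Announcement) (σ : WorkerStrategies) (i : Firm)
    (g : WorkerGroup) : Set Worker :=
  {x | σ.choice g x (offers a g x) = some i}

/-- The distribution of the workers of group `g` (normalised to mass one): the product of their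
productivity distribution and the distribution of indices. -/
def workerMeasure [MeasurableSpace Index] (M : Market) (μw : WorkerGroup → Measure Index)
    (g : WorkerGroup) : Measure Worker :=
  (volume.withDensity (fun v => ENNReal.ofReal (M.f g v))).prod (μw g)

/-- There are sets of positive measure of workers of groups `g` and `g'` hired by firm `i`, such
that every worker of the first set is paid a wage different from that of every worker of the
second. -/
def PaysDifferently [MeasurableSpace Index] (M : Market) (μw : WorkerGroup → Measure Index)
    (a : Firm → Announcement) (σ : WorkerStrategies) (i : Firm) (g g' : WorkerGroup) : Prop :=
  ∃ T T' : Set Worker,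
    MeasurableSet T ∧ T ⊆ hired a σ i g ∧ 0 < workerMeasure M μw g T ∧
    MeasurableSet T' ∧ T' ⊆ hired a σ i g' ∧ 0 < workerMeasure M μw g' T' ∧
    ∀ x ∈ T, ∀ y ∈ T', (a i).w g x ≠ (a i).w g' y

/-- Firm `i` violates the policy of the regime. -/
def Violates [MeasurableSpace Index] (M : Market) (μw : WorkerGroup → Measure Index)
    (a : Firm → Announcement) (σ : WorkerStrategies) (i : Firm) : Regime → Prop
  | .noEPSW => False
  | .groupBased => ∃ g g', g ≠ g' ∧ PaysDifferently M μw a σ i g g'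
  | .nonGroupBased => ∃ g g', PaysDifferently M μw a σ i g g'

open Classical in
/-- The payoff of firm `i`: its profit from the workers that it hires, but `-1` if the set of hired
workers of some group is not measurable or if the policy of the regime is violated. -/
def firmPayoff [MeasurableSpace Index] (M : Market) (μw : WorkerGroup → Measure Index)
    (r : Regime) (a : Firm → Announcement) (σ : WorkerStrategies) (i : Firm) : EReal :=
  if (∀ g, MeasurableSet (hired a σ i g)) ∧ ¬ Violates M μw a σ i r then
    (M.β : EReal) * extIntegral ((workerMeasure M μw .A).restrict (hired a σ i .A))
        (fun x => x.1.val - (a i).w .A x) +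
      extIntegral ((workerMeasure M μw .B).restrict (hired a σ i .B))
        (fun x => x.1.val - (a i).w .B x)
  else -1

/-- Subgame perfect Nash equilibrium: after every pair of announcements `b` each worker's decision
is optimal, and no firm gains by changing its announcement, given the other firm's announcement and
the strategies of the workers. -/
def IsSPNE [MeasurableSpace Index] (M : Market) (μw : WorkerGroup → Measure Index)
    (r : Regime) (a : Firm → Announcement) (σ : WorkerStrategies) : Prop :=
  (∀ (b : Firm → Announcement) (g : WorkerGroup) (x : Worker) (d : Option Firm),
    Available (offers b g x) d →
      workerPayoff (offers b g x) d ≤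
        workerPayoff (offers b g x) (σ.choice g x (offers b g x))) ∧
  ∀ (i : Firm) (a' : Announcement),
    firmPayoff M μw r (Function.update a i a') σ i ≤ firmPayoff M μw r a σ i

/-- The density of the workers of group `g` with productivity `v` who are hired by firm `i`. -/
def hiredDensity [MeasurableSpace Index] (M : Market) (μw : WorkerGroup → Measure Index)
    (a : Firm → Announcement) (σ : WorkerStrategies) (i : Firm) (g : WorkerGroup)
    (v : Productivity) : ℝ :=
  M.f g v * (μw g {t | (v, t) ∈ hired a σ i g}).toReal

open Classical in
/-- The wage paid by firm `i` to the workers of group `g` with productivity `v` that it hires, and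
zero if their density is zero. By the monotonicity of wage offers all of them are paid the same, so
that any one of them can be picked. -/
def paidWage [MeasurableSpace Index] (M : Market) (μw : WorkerGroup → Measure Index)
    (a : Firm → Announcement) (σ : WorkerStrategies) (i : Firm) (g : WorkerGroup)
    (v : Productivity) : ℝ :=
  if h : 0 < hiredDensity M μw a σ i g v ∧ ∃ t, (v, t) ∈ hired a σ i g then
    (a i).w g (v, h.2.choose)
  else 0

/-- The outcome associated with a strategy profile. -/
def gameOutcome [MeasurableSpace Index] (M : Market) (μw : WorkerGroup → Measure Index)
    (a : Firm → Announcement) (σ : WorkerStrategies) : Firm → FirmOutcome :=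
  fun i => ⟨hiredDensity M μw a σ i, paidWage M μw a σ i⟩

end LaborMarket

end

noncomputable section

namespace LaborMarket

/-! ## The space of productivities -/

/-! Equilibrium outcomes are core outcomes (`IsSPNE.isCoreOutcome`). A block by firm `j` via `O'`
becomes a profitable deviation: offer the wages of `O'` raised by a small constant `ε`. If a
worker's offer from the rival is at least the raised wage, she is employed in equilibrium at no less
than that wage. Hence each of the four blocking alternatives leaves enough workers of almost every
type whom the deviator strictly outbids the rival for (`le_measure_attractable`). Non-atomicity
allows a measurable selection of exactly the prescribed density among them
(`exists_measurable_sections`), and all of them accept whatever their tie-breaking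
(`exists_deviation`). A common shift of wages preserves equality of pay, and for small `ε` its cost
is below the gain in profit.

Core outcomes are equilibrium outcomes (`IsCoreOutcome.exists_spne`). Both firms announce the same
offers: every employed worker is offered her core wage by both, and she breaks ties in favour of the
firm that employs her in the core outcome. Such an announcement must be non-decreasing in
productivity, so the main point is that core wages in a group are a.e. monotone across firms and not
only within each of them (`IsCoreOutcome.exists_monotone_wages`). Given this, the outcome of any
profitable deviation would block: hiring a worker of the rival requires overbidding her wage, hiring
an own worker requires matching hers, and all others are unemployed.

Cross-firm monotonicity comes from two perturbations. If the rival pays less than the wage schedule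
`W` of a firm to workers with productivity above `W`, hiring all of them at `W` is profitable
(`IsCoreOutcome.productivity_le_of_lt`). If `W` equals productivity on a set where the rival pays
less, a firm with free wages gains by flattening its wages on a short interval to the right of a
density point of that set (`IsCoreOutcome.productivity_ne_of_lt`). A firm with a constant wage needs
only the first perturbation.

Two translations link the games: `paysDifferently_iff` and `wageRestriction_groupBased_iff` reduce
the two forms of the equal-pay rule to the relation `Differs`, and `firmPayoff_eq_profit` identifies
payoffs with profits. -/

lemma Productivity.measurable_val : Measurable Productivity.val := by
  intro s hs
  exact ((measurable_subtype_coe hs : MeasurableSet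
    ((Subtype.val : Set.Icc (0 : ℝ) 1 → ℝ) ⁻¹' s))).nullMeasurableSet

lemma Productivity.volume_preimage_val (s : Set ℝ) :
    (volume : Measure Productivity) (Productivity.val ⁻¹' s) = volume (s ∩ Set.Icc 0 1) := by
  have h : (volume : Measure Productivity) (Productivity.val ⁻¹' s)
      = (volume : Measure (Set.Icc (0 : ℝ) 1)) ((Subtype.val) ⁻¹' s) :=
    Measure.completion_apply _ _
  rw [h, ← volume_image_subtype_coe measurableSet_Icc, Subtype.image_preimage_coe, inter_comm]

instance : IsProbabilityMeasure (volume : Measure Productivity) := by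
  constructor
  have := Productivity.volume_preimage_val univ
  simpa using this

lemma Productivity.val_nonneg (v : Productivity) : 0 ≤ v.val := v.2.1

lemma Productivity.val_le_one (v : Productivity) : v.val ≤ 1 := v.2.2

lemma Productivity.val_le_val {v v' : Productivity} : v.val ≤ v'.val ↔ v ≤ v' := Iff.rfl

lemma Productivity.ae_val_ne (c : ℝ) : ∀ᵐ v : Productivity, v.val ≠ c := by
  have h := Productivity.volume_preimage_val {c}
  rw [measure_mono_null inter_subset_left (by simp)] at h
  exact compl_mem_ae_iff.mpr h

lemma Productivity.measurableSet_of_isUpperSet {s : Set Productivity} (hs : IsUpperSet s) :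
    MeasurableSet s := by
  have h : MeasurableSet (show Set (Set.Icc (0 : ℝ) 1) from s) := by
    apply Set.OrdConnected.measurableSet
    exact IsUpperSet.ordConnected hs
  exact h.nullMeasurableSet

lemma Productivity.measurable_of_monotone {F : Productivity → ℝ} (hF : Monotone F) :
    Measurable F := by
  refine measurable_of_Ioi fun c => Productivity.measurableSet_of_isUpperSet ?_
  intro a b hab ha
  exact lt_of_lt_of_le ha (hF hab)

/-- Within `D` each superlevel set is the trace of the upper set that it generates. This gives
measurability of `paidWage`, whose definition by choice gives none. -/
lemma Productivity.measurable_of_monotoneOn {F : Productivity → ℝ} {D : Set Productivity}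
    (hD : MeasurableSet D) (hF : MonotoneOn F D) (h0 : ∀ v ∉ D, F v = 0) : Measurable F := by
  refine measurable_of_Ioi fun c => ?_
  have h : F ⁻¹' Ioi c = (D ∩ {v | ∃ u ∈ D, u ≤ v ∧ c < F u}) ∪ (Dᶜ ∩ {_v | c < 0}) := by
    ext v
    by_cases hv : v ∈ D
    · simp only [mem_preimage, mem_Ioi, mem_union, mem_inter_iff, hv, mem_ofPred_eq, true_and,
        mem_compl_iff, not_true_eq_false, false_and, or_false]
      exact ⟨fun h => ⟨v, hv, le_rfl, h⟩,
        fun ⟨u, hu, huv, h⟩ => h.trans_le (hF hu hv huv)⟩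
    · simp [hv, h0 v hv]
  rw [h]
  refine (hD.inter (Productivity.measurableSet_of_isUpperSet ?_)).union
    (hD.compl.inter (MeasurableSet.const _))
  rintro a b hab ⟨u, hu, hua, h⟩
  exact ⟨u, hu, hua.trans hab, h⟩

/-! ## Extended integrals -/

section ExtIntegral

variable {α : Type*} [MeasurableSpace α] {μ : Measure α} {h k : α → ℝ}

lemma extIntegral_of_integrable (hh : Integrable h μ) :
    extIntegral μ h = ((∫ x, h x ∂μ : ℝ) : EReal) := by
  have h1 : ∫⁻ x, ENNReal.ofReal (h x) ∂μ ≠ ⊤ := hh.lintegral_lt_top.ne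
  have h2 : ∫⁻ x, ENNReal.ofReal (-h x) ∂μ ≠ ⊤ := hh.neg.lintegral_lt_top.ne
  rw [extIntegral, integral_eq_lintegral_pos_part_sub_lintegral_neg_part hh, EReal.coe_sub,
    EReal.coe_ennreal_toReal h1, EReal.coe_ennreal_toReal h2]

lemma extIntegral_congr (hhk : h =ᵐ[μ] k) : extIntegral μ h = extIntegral μ k := by
  rw [extIntegral, extIntegral]
  congr 2
  · exact lintegral_congr_ae (hhk.mono fun x hx => by simp only [hx])
  · exact lintegral_congr_ae (hhk.mono fun x hx => by simp only [hx])

lemma extIntegral_zero_measure : extIntegral (0 : Measure α) h = 0 := by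
  simp [extIntegral]

/-- The upper bound makes the positive part integrable, so an infinite negative part is the only
obstruction, and it would give `⊥`. -/
lemma integrable_of_extIntegral_ne_bot (hm : Measurable h) (C : ℝ) (hC : ∀ x, h x ≤ C)
    [IsFiniteMeasure μ] (hbot : extIntegral μ h ≠ ⊥) : Integrable h μ := by
  have h1 : ∫⁻ x, ENNReal.ofReal (h x) ∂μ ≠ ⊤ := by
    refine ((lintegral_mono fun x => ENNReal.ofReal_le_ofReal (hC x)).trans_lt ?_).ne
    rw [lintegral_const]
    exact ENNReal.mul_lt_top ENNReal.ofReal_lt_top (measure_lt_top _ _)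
  have h2 : ∫⁻ x, ENNReal.ofReal (-h x) ∂μ ≠ ⊤ := by
    intro h2
    apply hbot
    rw [extIntegral, h2]
    simp
  refine ⟨hm.aestronglyMeasurable, ?_⟩
  rw [hasFiniteIntegral_iff_norm]
  have : ∀ x, ENNReal.ofReal ‖h x‖ = ENNReal.ofReal (h x) + ENNReal.ofReal (-h x) := by
    intro x
    rcases le_total 0 (h x) with hx | hx
    · rw [Real.norm_of_nonneg hx, ENNReal.ofReal_of_nonpos (neg_nonpos.mpr hx), add_zero]
    · rw [Real.norm_of_nonpos hx, ENNReal.ofReal_of_nonpos hx, zero_add]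
  simp_rw [this]
  rw [lintegral_add_left hm.ennreal_ofReal]
  exact ENNReal.add_lt_top.mpr ⟨h1.lt_top, h2.lt_top⟩

end ExtIntegral

/-! ## Profits -/

/-- Profit density of the firm outcome `O` in the group `g`. -/
def profitDensity (O : FirmOutcome) (g : WorkerGroup) (v : Productivity) : ℝ :=
  (v.val - O.w g v) * O.f g v

lemma Market.β_pos (M : Market) : 0 < M.β := zero_lt_one.trans_le M.one_le_β

lemma Market.f_pos (M : Market) (g : WorkerGroup) (v : Productivity) : 0 < M.f g v := by
  obtain ⟨c, hc, h⟩ := M.lower g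
  exact hc.trans_le (h v)

lemma profit_eq (M : Market) (O : FirmOutcome) :
    profit M O = (M.β : EReal) * extIntegral volume (profitDensity O .A) +
      extIntegral volume (profitDensity O .B) := rfl

lemma profit_of_integrable (M : Market) {O : FirmOutcome}
    (h : ∀ g, Integrable (profitDensity O g)) :
    profit M O = ((M.β * (∫ v, profitDensity O .A v) + ∫ v, profitDensity O .B v : ℝ) : EReal) := by
  rw [profit_eq, extIntegral_of_integrable (h _), extIntegral_of_integrable (h _), EReal.coe_add,
    EReal.coe_mul]

lemma profit_congr (M : Market) {O O' : FirmOutcome}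
    (h : ∀ g, profitDensity O g =ᵐ[volume] profitDensity O' g) : profit M O = profit M O' := by
  rw [profit_eq, profit_eq, extIntegral_congr (h _), extIntegral_congr (h _)]

section FirmOutcome

variable {M : Market} {r : Regime} {O : FirmOutcome}

lemma IsFirmOutcome.measurable_profitDensity (hO : IsFirmOutcome M r O) (g : WorkerGroup) :
    Measurable (profitDensity O g) :=
  (Productivity.measurable_val.sub (hO.measurable_w g)).mul (hO.measurable_f g)

lemma IsFirmOutcome.profitDensity_le (hO : IsFirmOutcome M r O) (g : WorkerGroup) :
    ∃ C, ∀ v, profitDensity O g v ≤ C := by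
  obtain ⟨C, hC⟩ := M.upper g
  refine ⟨C, fun v => ?_⟩
  have h1 := hO.f_nonneg g v
  have h2 := (hO.f_le g v).trans (hC v)
  have h3 := hO.w_nonneg g v
  have h4 := v.val_le_one
  unfold profitDensity
  nlinarith [mul_nonneg h3 h1, mul_nonneg (sub_nonneg.mpr h4) h1]

lemma IsFirmOutcome.integrable_of_profit_ne_bot (hO : IsFirmOutcome M r O)
    (hp : profit M O ≠ ⊥) (g : WorkerGroup) : Integrable (profitDensity O g) := by
  obtain ⟨C, hC⟩ := hO.profitDensity_le g
  refine integrable_of_extIntegral_ne_bot (hO.measurable_profitDensity g) C hC fun hbot => hp ?_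
  rw [profit_eq]
  cases g with
  | A =>
    rw [hbot, EReal.coe_mul_bot_of_pos M.β_pos, EReal.bot_add]
  | B =>
    rw [hbot, EReal.add_bot]

lemma IsFirmOutcome.integrable_of_profit_nonneg (hO : IsFirmOutcome M r O)
    (hp : 0 ≤ profit M O) (g : WorkerGroup) : Integrable (profitDensity O g) :=
  hO.integrable_of_profit_ne_bot (ne_bot_of_le_ne_bot (by simp) hp) g

end FirmOutcome


/-! ## Equal-pay restrictions -/

/-- A countable family of Borel sets separates the points of `ℝ`; knowing which side of each carries
`ν` leaves at most one point. The zero measure is allowed. -/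
lemma exists_ae_eq_const_of_zero_one (ν : Measure ℝ)
    (h : ∀ s, MeasurableSet s → ν s = 0 ∨ ν sᶜ = 0) : ∃ c, ∀ᵐ x ∂ν, x = c := by
  refine Filter.exists_eventuallyEq_const_of_forall_separating (f := (id : ℝ → ℝ)) MeasurableSet
    fun U hU => ?_
  rcases h U hU with h | h
  · exact Or.inr (measure_eq_zero_iff_ae_notMem.mp h)
  · exact Or.inl (by simpa using measure_eq_zero_iff_ae_notMem.mp h)

/-- The outcome `O` pays different wages to sets of positive measure of workers of the groups `g`
and `g'`. -/
def Differs (O : FirmOutcome) (g g' : WorkerGroup) : Prop :=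
  ∃ V V' : Set Productivity, MeasurableSet V ∧ 0 < volume V ∧ MeasurableSet V' ∧ 0 < volume V' ∧
    (∀ v ∈ V, 0 < O.f g v) ∧ (∀ v ∈ V', 0 < O.f g' v) ∧ ∀ v ∈ V, ∀ v' ∈ V', O.w g v ≠ O.w g' v'

/-- The outcome `O` hires almost no worker of group `g`. -/
def HiresNone (O : FirmOutcome) (g : WorkerGroup) : Prop := ∀ᵐ v, ¬ 0 < O.f g v

/-- The outcome `O` pays the wage `c` to almost all workers. -/
def PaysConstant (O : FirmOutcome) (c : ℝ) : Prop := ∀ g, ∀ᵐ v, 0 < O.f g v → O.w g v = c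

/-- The distribution of the wages that `O` pays in the group `g`. -/
def wageLaw (O : FirmOutcome) (g : WorkerGroup) : Measure ℝ :=
  (volume.restrict {v | 0 < O.f g v}).map (O.w g)

lemma WorkerGroup.eq_or_eq_other (g g' : WorkerGroup) : g' = g ∨ g' = g.other := by
  cases g <;> cases g' <;> simp [WorkerGroup.other]

lemma WorkerGroup.other_ne (g : WorkerGroup) : g.other ≠ g := by
  cases g <;> simp [WorkerGroup.other]

lemma WorkerGroup.other_other (g : WorkerGroup) : g.other.other = g := by
  cases g <;> rfl

/-- The functions that constitute the outcome `O` are measurable. -/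
structure FirmOutcome.IsMeasurable (O : FirmOutcome) : Prop where
  f : ∀ g, Measurable (O.f g)
  w : ∀ g, Measurable (O.w g)

lemma IsFirmOutcome.isMeasurable {M : Market} {r : Regime} {O : FirmOutcome}
    (hO : IsFirmOutcome M r O) : O.IsMeasurable := ⟨hO.measurable_f, hO.measurable_w⟩

section

variable {O : FirmOutcome}

lemma measurableSet_hires (hO : O.IsMeasurable) (g : WorkerGroup) : MeasurableSet {v | 0 < O.f g v} :=
  measurableSet_lt measurable_const (hO.f g)

lemma wageLaw_apply (hO : O.IsMeasurable) (g : WorkerGroup) {s : Set ℝ} (hs : MeasurableSet s) :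
    wageLaw O g s = volume (O.w g ⁻¹' s ∩ {v | 0 < O.f g v}) := by
  rw [wageLaw, Measure.map_apply (hO.w g) hs, Measure.restrict_apply (hO.w g hs)]

/-- Otherwise the workers of `g` with wages in `s` and those of `g'` with wages outside `s` witness
`Differs`. -/
lemma wageLaw_eq_zero_or (hO : O.IsMeasurable) {g g' : WorkerGroup} (h : ¬ Differs O g g') {s : Set ℝ}
    (hs : MeasurableSet s) : wageLaw O g s = 0 ∨ wageLaw O g' sᶜ = 0 := by
  rw [wageLaw_apply hO g hs, wageLaw_apply hO g' hs.compl]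
  by_contra! hcon
  refine h ⟨_, _, (hO.w g hs).inter (measurableSet_hires hO g), pos_iff_ne_zero.mpr hcon.1,
    (hO.w g' hs.compl).inter (measurableSet_hires hO g'), pos_iff_ne_zero.mpr hcon.2,
    fun v hv => hv.2, fun v hv => hv.2, fun v hv v' hv' heq => hv'.1 ?_⟩
  rw [← heq]
  exact hv.1

lemma hiresNone_of_wageLaw (hO : O.IsMeasurable) {g : WorkerGroup} (h : wageLaw O g univ = 0) : HiresNone O g := by
  rw [wageLaw_apply hO g MeasurableSet.univ] at h
  simpa [HiresNone] using measure_eq_zero_iff_ae_notMem.mp h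

lemma exists_paysConstant_of_add (hO : O.IsMeasurable)
    (h : ∀ s, MeasurableSet s → (wageLaw O .A + wageLaw O .B) s = 0 ∨
      (wageLaw O .A + wageLaw O .B) sᶜ = 0) : ∃ c, PaysConstant O c := by
  obtain ⟨c, hc⟩ := exists_ae_eq_const_of_zero_one _ h
  rw [ae_add_measure_iff] at hc
  refine ⟨c, fun g => ?_⟩
  have hg : ∀ᵐ x ∂wageLaw O g, x = c := by
    cases g
    · exact hc.1
    · exact hc.2
  rw [wageLaw, ae_map_iff (p := fun x => x = c) (hO.w g).aemeasurable (measurableSet_singleton c),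
    ae_restrict_iff' (measurableSet_hires hO g)] at hg
  exact hg

lemma exists_paysConstant_of_forall_not_differs (hO : O.IsMeasurable) (h : ∀ g g', ¬ Differs O g g') :
    ∃ c, PaysConstant O c := by
  refine exists_paysConstant_of_add hO fun s hs => ?_
  have hAA := wageLaw_eq_zero_or hO (h .A .A) hs
  have hAB := wageLaw_eq_zero_or hO (h .A .B) hs
  have hBA := wageLaw_eq_zero_or hO (h .B .A) hs
  have hBB := wageLaw_eq_zero_or hO (h .B .B) hs
  simp only [Measure.add_apply, add_eq_zero]
  tauto

lemma hiresNone_or_paysConstant_of_not_differs (hO : O.IsMeasurable) (hAB : ¬ Differs O .A .B) :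
    (∃ g, HiresNone O g) ∨ ∃ c, PaysConstant O c := by
  by_cases hA : wageLaw O .A univ = 0
  · exact Or.inl ⟨.A, hiresNone_of_wageLaw hO hA⟩
  by_cases hB : wageLaw O .B univ = 0
  · exact Or.inl ⟨.B, hiresNone_of_wageLaw hO hB⟩
  refine Or.inr (exists_paysConstant_of_add hO fun s hs => ?_)
  -- Used for `s` and for its complement: since neither law vanishes, both must vanish on the same
  -- side.
  have h1 := wageLaw_eq_zero_or hO hAB hs
  have h2 := wageLaw_eq_zero_or hO hAB hs.compl
  rw [compl_compl] at h2
  have h3 : ¬ (wageLaw O .A s = 0 ∧ wageLaw O .A sᶜ = 0) := fun h => hA <| by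
    rw [← measure_add_measure_compl hs, h.1, h.2, add_zero]
  have h4 : ¬ (wageLaw O .B s = 0 ∧ wageLaw O .B sᶜ = 0) := fun h => hB <| by
    rw [← measure_add_measure_compl hs, h.1, h.2, add_zero]
  simp only [Measure.add_apply, add_eq_zero]
  tauto

/-- Pointwise distinct wages are upgraded to wages separated by a gap, as the comparison of supremum
and infimum in `WageRestriction` requires. Rational pairs `q < q'` cover `V ×ˢ V'` by countably many
rectangles, one of which has positive product measure. -/
lemma exists_separated_of_differs (hO : O.IsMeasurable) {g g' : WorkerGroup} (h : Differs O g g') :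
    ∃ q : ℝ, ∃ q' : ℝ, q < q' ∧ ∃ V V' : Set Productivity,
      MeasurableSet V ∧ 0 < volume V ∧ MeasurableSet V' ∧ 0 < volume V' ∧
      (∀ v ∈ V, 0 < O.f g v) ∧ (∀ v ∈ V', 0 < O.f g' v) ∧
      ((∀ v ∈ V, O.w g v ≤ q) ∧ (∀ v ∈ V', q' ≤ O.w g' v) ∨
        (∀ v ∈ V, q' ≤ O.w g v) ∧ (∀ v ∈ V', O.w g' v ≤ q)) := by
  obtain ⟨V, V', hV, hV0, hV', hV'0, hVf, hV'f, hne⟩ := h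
  have hpos : 0 < (volume.prod volume) (V ×ˢ V') := by
    rw [Measure.prod_prod]
    exact ENNReal.mul_pos hV0.ne' hV'0.ne'
  have hcover : V ×ˢ V' ⊆ ⋃ p : ℚ × ℚ, {_x | p.1 < p.2} ∩
      ((V ∩ {v | O.w g v ≤ p.1}) ×ˢ (V' ∩ {v | (p.2 : ℝ) ≤ O.w g' v}) ∪
        (V ∩ {v | (p.2 : ℝ) ≤ O.w g v}) ×ˢ (V' ∩ {v | O.w g' v ≤ p.1})) := by
    rintro ⟨v, v'⟩ ⟨hv, hv'⟩
    simp only at hv hv'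
    rw [mem_iUnion]
    rcases lt_or_gt_of_ne (hne v hv v' hv') with hlt | hlt
    · obtain ⟨q, hq1, hq2⟩ := exists_rat_btwn hlt
      obtain ⟨q', hq1', hq2'⟩ := exists_rat_btwn hq2
      exact ⟨(q, q'), by exact_mod_cast hq1', Or.inl ⟨⟨hv, hq1.le⟩, hv', hq2'.le⟩⟩
    · obtain ⟨q, hq1, hq2⟩ := exists_rat_btwn hlt
      obtain ⟨q', hq1', hq2'⟩ := exists_rat_btwn hq2
      exact ⟨(q, q'), by exact_mod_cast hq1', Or.inr ⟨⟨hv, hq2'.le⟩, hv', hq1.le⟩⟩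
  obtain ⟨⟨q, q'⟩, hp⟩ := exists_measure_pos_of_not_measure_iUnion_null
    (hpos.trans_le (measure_mono hcover)).ne'
  have hlt : q < q' := by
    by_contra hcon
    simp [hcon] at hp
  have hmle : ∀ (g : WorkerGroup) (c : ℝ), MeasurableSet {v | O.w g v ≤ c} :=
    fun g c => measurableSet_le (hO.w g) measurable_const
  have hmge : ∀ (g : WorkerGroup) (c : ℝ), MeasurableSet {v | c ≤ O.w g v} :=
    fun g c => measurableSet_le measurable_const (hO.w g)
  refine ⟨q, q', by exact_mod_cast hlt, ?_⟩
  have hp' := hp.trans_le ((measure_mono inter_subset_right).trans (measure_union_le _ _))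
  rw [Measure.prod_prod, Measure.prod_prod] at hp'
  rcases (pos_iff_ne_zero.mp hp') |> fun h => (not_and_or.mp (mt add_eq_zero.mpr h)) with h | h
  · obtain ⟨h1, h2⟩ := mul_ne_zero_iff.mp h
    exact ⟨_, _, hV.inter (hmle g q), pos_iff_ne_zero.mpr h1, hV'.inter (hmge g' q'),
      pos_iff_ne_zero.mpr h2, fun v hv => hVf v hv.1, fun v hv => hV'f v hv.1,
      Or.inl ⟨fun v hv => hv.2, fun v hv => hv.2⟩⟩
  · obtain ⟨h1, h2⟩ := mul_ne_zero_iff.mp h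
    exact ⟨_, _, hV.inter (hmge g q'), pos_iff_ne_zero.mpr h1, hV'.inter (hmle g' q),
      pos_iff_ne_zero.mpr h2, fun v hv => hVf v hv.1, fun v hv => hV'f v hv.1,
      Or.inr ⟨fun v hv => hv.2, fun v hv => hv.2⟩⟩

lemma wageRestriction_groupBased_iff (hO : O.IsMeasurable) :
    WageRestriction O .groupBased ↔ ∀ g g', g ≠ g' → ¬ Differs O g g' := by
  constructor
  · intro h g g' hgg' hd
    obtain rfl : g' = g.other := (g.eq_or_eq_other g').resolve_left hgg'.symm
    obtain ⟨q, q', hlt, V, V', hV, hV0, hV', hV'0, hVf, hV'f, h1 | h1⟩ :=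
      exists_separated_of_differs hO hd
    · refine h ⟨g, V, V', hV, hV0, hV', hV'0, hVf, hV'f, ?_⟩
      refine (iSup₂_le fun v hv => EReal.coe_le_coe (h1.1 v hv)).trans_lt
        ((EReal.coe_lt_coe hlt).trans_le (le_iInf₂ fun v hv => EReal.coe_le_coe (h1.2 v hv)))
    · refine h ⟨g.other, V', V, hV', hV'0, hV, hV0, hV'f, by rwa [g.other_other], ?_⟩
      rw [g.other_other]
      refine (iSup₂_le fun v hv => EReal.coe_le_coe (h1.2 v hv)).trans_lt
        ((EReal.coe_lt_coe hlt).trans_le (le_iInf₂ fun v hv => EReal.coe_le_coe (h1.1 v hv)))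
  · rintro h ⟨g, V, V', hV, hV0, hV', hV'0, hVf, hV'f, hlt⟩
    refine h g g.other g.other_ne.symm ⟨V, V', hV, hV0, hV', hV'0, hVf, hV'f, ?_⟩
    intro v hv v' hv' heq
    have h1 : (O.w g v : EReal) ≤ ⨆ v ∈ V, (O.w g v : EReal) :=
      le_iSup₂ (f := fun v (_ : v ∈ V) => (O.w g v : EReal)) v hv
    have h2 : (⨅ v ∈ V', (O.w g.other v : EReal)) ≤ O.w g.other v' :=
      iInf₂_le (f := fun v (_ : v ∈ V') => (O.w g.other v : EReal)) v' hv'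
    have h3 := h1.trans_lt (hlt.trans_le h2)
    rw [heq] at h3
    exact lt_irrefl _ h3

end

lemma HiresNone.not_differs_left {O : FirmOutcome} {g g' : WorkerGroup} (h : HiresNone O g) :
    ¬ Differs O g g' := by
  rintro ⟨V, -, -, hV0, -, -, hVf, -⟩
  exact hV0.ne' (measure_mono_null (fun v hv => not_not.mpr (hVf v hv)) (ae_iff.mp h))

lemma Differs.symm {O : FirmOutcome} {g g' : WorkerGroup} (h : Differs O g g') :
    Differs O g' g := by
  obtain ⟨V, V', hV, hV0, hV', hV'0, hVf, hV'f, hne⟩ := h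
  exact ⟨V', V, hV', hV'0, hV, hV0, hV'f, hVf, fun v hv v' hv' => (hne v' hv' v hv).symm⟩

lemma PaysConstant.exists_mem {O : FirmOutcome} {c : ℝ} (h : PaysConstant O c) {g : WorkerGroup}
    {V : Set Productivity} (hV0 : 0 < volume V) (hVf : ∀ v ∈ V, 0 < O.f g v) :
    ∃ v ∈ V, O.w g v = c := by
  by_contra! hcon
  refine hV0.ne' (measure_mono_null (fun v hv => ?_) (ae_iff.mp (h g)))
  exact fun hv' => hcon v hv (hv' (hVf v hv))

lemma PaysConstant.not_differs {O : FirmOutcome} {c : ℝ} (h : PaysConstant O c)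
    (g g' : WorkerGroup) : ¬ Differs O g g' := by
  rintro ⟨V, V', hV, hV0, hV', hV'0, hVf, hV'f, hne⟩
  obtain ⟨v, hv, hvc⟩ := h.exists_mem hV0 hVf
  obtain ⟨v', hv', hvc'⟩ := h.exists_mem hV'0 hV'f
  exact hne v hv v' hv' (hvc.trans hvc'.symm)


/-! ## Non-atomic measures -/

section NonAtomic

variable {α : Type*} [MeasurableSpace α] {μ : Measure α} [IsFiniteMeasure μ]

/-- Of a proper piece of `s` and its remainder, one has at most half the mass, and both have
positive mass. -/
lemma NonAtomic.exists_half (h : NonAtomic μ) {s : Set α} (hs : MeasurableSet s) (h0 : 0 < μ s) :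
    ∃ t, MeasurableSet t ∧ t ⊆ s ∧ 0 < μ t ∧ μ t ≤ μ s / 2 := by
  obtain ⟨t, ht, hts, ht0, hlt⟩ := h s hs h0
  by_cases hle : μ t ≤ μ s / 2
  · exact ⟨t, ht, hts, ht0, hle⟩
  · have hd : μ (s \ t) = μ s - μ t := measure_sdiff hts ht.nullMeasurableSet (measure_ne_top _ _)
    refine ⟨s \ t, hs.diff ht, sdiff_subset, ?_, ?_⟩
    · rw [hd]
      exact tsub_pos_of_lt hlt
    · rw [hd, tsub_le_iff_right]
      calc μ s = μ s / 2 + μ s / 2 := (ENNReal.add_halves _).symm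
        _ ≤ μ s / 2 + μ t := by gcongr; exact (not_le.mp hle).le

lemma NonAtomic.exists_small (h : NonAtomic μ) {s : Set α} (hs : MeasurableSet s) (h0 : 0 < μ s)
    {ε : ENNReal} (hε : 0 < ε) :
    ∃ t, MeasurableSet t ∧ t ⊆ s ∧ 0 < μ t ∧ μ t ≤ ε := by
  have hn : ∀ n : ℕ, ∃ t, MeasurableSet t ∧ t ⊆ s ∧ 0 < μ t ∧ μ t ≤ μ s * (2⁻¹) ^ n := by
    intro n
    induction n with
    | zero => exact ⟨s, hs, Subset.rfl, h0, by simp⟩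
    | succ n ih =>
      obtain ⟨t, ht, hts, ht0, hle⟩ := ih
      obtain ⟨u, hu, hut, hu0, hule⟩ := h.exists_half ht ht0
      refine ⟨u, hu, hut.trans hts, hu0, hule.trans ?_⟩
      rw [pow_succ, ← mul_assoc, ENNReal.div_eq_inv_mul, mul_comm]
      gcongr
  have hlim : Filter.Tendsto (fun n : ℕ => μ s * (2⁻¹ : ENNReal) ^ n) Filter.atTop (nhds 0) := by
    have := ENNReal.Tendsto.const_mul (a := μ s)
      (ENNReal.tendsto_pow_atTop_nhds_zero_of_lt_one (r := 2⁻¹) (by simp))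
      (Or.inr (measure_ne_top μ s))
    simpa using this
  obtain ⟨n, hnε⟩ := (hlim.eventually (gt_mem_nhds hε)).exists
  obtain ⟨t, ht, hts, ht0, hle⟩ := hn n
  exact ⟨t, ht, hts, ht0, hle.trans hnε.le⟩

/-- A maximal disjoint family of sets of positive measure at most `ε` is countable because `μ` is
finite, and by maximality and `NonAtomic.exists_small` it misses only a null set. -/
lemma NonAtomic.exists_cover (h : NonAtomic μ) {ε : ENNReal} (hε : 0 < ε) :
    ∃ e : ℕ → Set α, (∀ n, MeasurableSet (e n)) ∧ (∀ n, μ (e n) ≤ ε) ∧ μ (⋃ n, e n)ᶜ = 0 := by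
  obtain ⟨F, hF⟩ := zorn_subset
    {F : Set (Set α) | (∀ t ∈ F, MeasurableSet t ∧ 0 < μ t ∧ μ t ≤ ε) ∧ F.PairwiseDisjoint id} (by
      intro c hc hchain
      refine ⟨⋃₀ c, ⟨?_, ?_⟩, fun s hs => subset_sUnion_of_mem hs⟩
      · rintro t ⟨s, hs, hts⟩
        exact (hc hs).1 t hts
      · exact (pairwiseDisjoint_sUnion hchain.directedOn).mpr fun s hs => (hc hs).2)
  have hcount : F.Countable := by
    have := Measure.countable_meas_pos_of_disjoint_iUnion (μ := μ) (As := fun t : F => (t : Set α))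
      (fun t => (hF.prop.1 t t.2).1) (fun s t hst => hF.prop.2 s.2 t.2 (Subtype.coe_ne_coe.mpr hst))
    have huniv : {t : F | 0 < μ (t : Set α)} = univ :=
      eq_univ_of_forall fun t => (hF.prop.1 t t.2).2.1
    rw [huniv] at this
    exact Set.countable_coe_iff.mp (Set.countable_univ_iff.mp this)
  obtain ⟨e, he⟩ := (hcount.insert ∅).exists_eq_range (insert_nonempty _ _)
  have hmem : ∀ n, e n = ∅ ∨ e n ∈ F := fun n => by
    have : e n ∈ insert ∅ F := he ▸ mem_range_self n
    exact this
  have hmeas : ∀ n, MeasurableSet (e n) := fun n => by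
    rcases hmem n with hn | hn
    · rw [hn]; exact MeasurableSet.empty
    · exact (hF.prop.1 _ hn).1
  refine ⟨e, hmeas, fun n => ?_, ?_⟩
  · rcases hmem n with hn | hn
    · simp [hn]
    · exact (hF.prop.1 _ hn).2.2
  · by_contra hne
    obtain ⟨t, ht, hts, ht0, htε⟩ :=
      h.exists_small (MeasurableSet.iUnion hmeas).compl (pos_iff_ne_zero.mpr hne) hε
    have hdisj : ∀ s ∈ F, Disjoint t s := by
      intro s hs
      have hs' : s ∈ range e := he ▸ mem_insert_of_mem _ hs
      obtain ⟨n, rfl⟩ := hs'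
      exact disjoint_left.mpr fun x hx hxn => hts hx (mem_iUnion.mpr ⟨n, hxn⟩)
    have hins : insert t F ⊆ F := hF.le_of_ge (y := insert t F) ⟨by
        rintro s (rfl | hs)
        · exact ⟨ht, ht0, htε⟩
        · exact hF.prop.1 s hs, hF.prop.2.insert fun s hs _ => hdisj s hs⟩ (subset_insert _ _)
    have := hdisj t (hins (mem_insert _ _))
    rw [disjoint_self.mp this] at ht0
    simp at ht0

/-- Substitute for a continuously distributed coordinate on an arbitrary sigma-algebra. A point is
coded by its memberships in countable covers of mesh `1/(k+1)`, and the code is embedded measurably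
into `[0, 1]`. For each `k`, a fibre lies in one set of the cover or in the null set that the cover
misses. -/
lemma NonAtomic.exists_measurable_null_fibers (h : NonAtomic μ) :
    ∃ U : α → ℝ, Measurable U ∧ (∀ x, U x ∈ Set.Icc (0 : ℝ) 1) ∧ ∀ c, μ (U ⁻¹' {c}) = 0 := by
  choose e he hle hcov using fun k : ℕ => h.exists_cover (ε := ((k : ENNReal) + 1)⁻¹) (by simp)
  let G : α → (ℕ × ℕ → ℝ) := fun x p => (e p.1 p.2).indicator 1 x
  have hG : Measurable G := measurable_pi_lambda _ fun p =>
    (measurable_one.indicator (he p.1 p.2))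
  let e' : (ℕ × ℕ → ℝ) → ℝ := fun y => (unitInterval.sigmoid (embeddingReal (ℕ × ℕ → ℝ) y) : ℝ)
  have he' : MeasurableEmbedding e' := (MeasurableEmbedding.subtype_coe measurableSet_Icc).comp
    (measurableEmbedding_sigmoid_comp_embeddingReal _)
  refine ⟨e' ∘ G, he'.measurable.comp hG,
    fun x => (unitInterval.sigmoid (embeddingReal (ℕ × ℕ → ℝ) (G x))).2, fun c => ?_⟩
  have hk : ∀ k : ℕ, μ ((e' ∘ G) ⁻¹' {c}) ≤ ((k : ENNReal) + 1)⁻¹ := by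
    intro k
    by_cases hx : ∃ x n, e' (G x) = c ∧ x ∈ e k n
    · obtain ⟨x, n, hxc, hxn⟩ := hx
      refine (measure_mono fun y hy => ?_).trans (hle k n)
      have hxy : G y = G x :=
        he'.injective (by rw [hxc]; exact hy)
      by_contra hyn
      have := congrFun hxy (k, n)
      simp [G, hxn, hyn] at this
    · push Not at hx
      refine (measure_mono_null (fun y hy => ?_) (hcov k)).trans_le zero_le
      rw [mem_compl_iff, mem_iUnion]
      rintro ⟨n, hn⟩
      exact hx y n hy hn
  have hlim : Filter.Tendsto (fun k : ℕ => ((k : ENNReal) + 1)⁻¹) Filter.atTop (nhds 0) := by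
    have := (ENNReal.tendsto_inv_nat_nhds_zero).comp (Filter.tendsto_add_atTop_nat 1)
    refine this.congr fun k => by simp
  exact le_antisymm (ge_of_tendsto' hlim hk) zero_le

/-- Null fibres make `s ↦ μ (E ∩ {U ≤ s})` continuous, so it attains `ρ` at a cutoff `b`, and the
set in question is `E ∩ {U ≤ b}`. The description by ranks instead of `b` keeps the set jointly
measurable when `E` and `ρ` vary with a parameter. -/
lemma measure_rank_le {U : α → ℝ} (hU : Measurable U) (hI : ∀ x, U x ∈ Set.Icc (0 : ℝ) 1)
    (h0 : ∀ c, μ (U ⁻¹' {c}) = 0)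
    {E : Set α} (hE : MeasurableSet E) {ρ : ENNReal} (hρ : ρ ≤ μ E) :
    μ {t ∈ E | μ (E ∩ {t' | U t' ≤ U t}) ≤ ρ} = ρ := by
  set G : ℝ → ENNReal := fun s => μ (E ∩ {t | U t ≤ s}) with hG
  have hmono : Monotone G := fun a b hab =>
    measure_mono (inter_subset_inter_right _ fun t (ht : U t ≤ a) => ht.trans hab)
  have hmeas : ∀ s, MeasurableSet (E ∩ {t | U t ≤ s}) := fun s =>
    hE.inter (measurableSet_le hU measurable_const)
  have hG1 : ∀ s, 1 ≤ s → G s = μ E := fun s hs => by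
    simp only [hG]
    congr 1
    exact inter_eq_left.mpr fun t _ => (hI t).2.trans hs
  let A : Set ℝ := {s | s ∈ Set.Icc (0 : ℝ) 1 ∧ G s ≤ ρ}
  have hA0 : (0 : ℝ) ∈ A := by
    refine ⟨by simp, (measure_mono_null (fun t ht => ?_) (h0 0)).trans_le zero_le⟩
    exact le_antisymm ht.2 (hI t).1
  have hAb : BddAbove A := ⟨1, fun s hs => hs.1.2⟩
  set b := sSup A with hb
  have hb0 : 0 ≤ b := le_csSup hAb hA0
  have hb1 : b ≤ 1 := csSup_le ⟨0, hA0⟩ fun s hs => hs.1.2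
  -- Continuity from the left; this is where the fibre over `b` has to be null.
  have hle : G b ≤ ρ := by
    obtain ⟨u, humono, hulim, huA⟩ := exists_seq_tendsto_sSup ⟨0, hA0⟩ hAb
    have hsub : E ∩ {t | U t ≤ b} ⊆ (⋃ n, E ∩ {t | U t ≤ u n}) ∪ U ⁻¹' {b} := by
      rintro t ⟨htE, ht⟩
      rcases lt_or_eq_of_le (show U t ≤ b from ht) with hlt | heq
      · obtain ⟨n, hn⟩ := (hulim.eventually (lt_mem_nhds hlt)).exists
        exact Or.inl (mem_iUnion.mpr ⟨n, htE, hn.le⟩)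
      · exact Or.inr heq
    calc G b ≤ μ (⋃ n, E ∩ {t | U t ≤ u n}) + μ (U ⁻¹' {b}) :=
          (measure_mono hsub).trans (measure_union_le _ _)
      _ = μ (⋃ n, E ∩ {t | U t ≤ u n}) := by rw [h0, add_zero]
      _ = ⨆ n, μ (E ∩ {t | U t ≤ u n}) := Monotone.measure_iUnion fun m n hmn =>
          inter_subset_inter_right _ fun t (ht : U t ≤ u m) => ht.trans (humono hmn)
      _ ≤ ρ := iSup_le fun n => (huA n).2
  -- Continuity from the right: points beyond `b` are either outside `A` because they exceed its
  -- supremum, or above `1`, where `G` is `μ E`.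
  have hge : ρ ≤ G b := by
    have hlim : Filter.Tendsto (fun n : ℕ => G (b + 1 / ((n : ℝ) + 1))) Filter.atTop
        (nhds (μ (⋂ n : ℕ, E ∩ {t | U t ≤ b + 1 / ((n : ℝ) + 1)}))) := by
      refine tendsto_measure_iInter_atTop (fun n => (hmeas _).nullMeasurableSet) ?_
        ⟨0, measure_ne_top _ _⟩
      intro m n hmn
      refine inter_subset_inter_right _ fun t (ht : U t ≤ _) => ht.trans ?_
      gcongr
    have hint : (⋂ n : ℕ, E ∩ {t | U t ≤ b + 1 / ((n : ℝ) + 1)}) ⊆ E ∩ {t | U t ≤ b} := by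
      intro t ht
      rw [mem_iInter] at ht
      refine ⟨(ht 0).1, ?_⟩
      have hl := (tendsto_one_div_add_atTop_nhds_zero_nat (𝕜 := ℝ)).const_add b
      rw [add_zero] at hl
      exact ge_of_tendsto' hl fun n => (ht n).2
    refine (ge_of_tendsto' hlim fun n => ?_).trans (measure_mono hint)
    have hpos : (0 : ℝ) < 1 / ((n : ℝ) + 1) := by positivity
    by_cases h1 : b + 1 / ((n : ℝ) + 1) ≤ 1
    · by_contra hcon
      have : b + 1 / ((n : ℝ) + 1) ∈ A := ⟨⟨by linarith, h1⟩, (not_le.mp hcon).le⟩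
      linarith [le_csSup hAb this]
    · rw [hG1 _ (not_le.mp h1).le]
      exact hρ
  have hset : {t ∈ E | G (U t) ≤ ρ} = E ∩ {t | U t ≤ b} := by
    ext t
    exact and_congr_right fun _ => ⟨fun ht => le_csSup hAb ⟨hI t, ht⟩,
      fun ht => (hmono ht).trans hle⟩
  calc μ {t ∈ E | G (U t) ≤ ρ} = G b := by rw [hset]
    _ = ρ := le_antisymm hle hge

end NonAtomic

/-- The rank construction is carried out in all fibres at once with the same `U`; the rank is
jointly measurable by Tonelli, so no cutoff has to be selected measurably. -/
lemma exists_measurable_sections {β α : Type*} [MeasurableSpace β] [MeasurableSpace α]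
    {μ : Measure α} [IsFiniteMeasure μ] (h : NonAtomic μ) {E : Set (β × α)} (hE : MeasurableSet E)
    {ρ : β → ENNReal} (hρ : Measurable ρ) (hle : ∀ v, ρ v ≤ μ {t | (v, t) ∈ E}) :
    ∃ S ⊆ E, MeasurableSet S ∧ ∀ v, μ {t | (v, t) ∈ S} = ρ v := by
  obtain ⟨U, hU, hI, h0⟩ := h.exists_measurable_null_fibers
  have hR : Measurable fun p : β × ℝ => μ {t' | (p.1, t') ∈ E ∧ U t' ≤ p.2} := by
    refine measurable_measure_prodMk_left (s := {x : (β × ℝ) × α | (x.1.1, x.2) ∈ E ∧ U x.2 ≤ x.1.2})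
      ?_
    exact ((measurable_fst.fst.prodMk measurable_snd) hE).inter
      (measurableSet_le (hU.comp measurable_snd) measurable_fst.snd)
  refine ⟨E ∩ {x | μ {t' | (x.1, t') ∈ E ∧ U t' ≤ U x.2} ≤ ρ x.1}, inter_subset_left,
    hE.inter (measurableSet_le (hR.comp (measurable_fst.prodMk (hU.comp measurable_snd)))
      (hρ.comp measurable_fst)), fun v => ?_⟩
  exact measure_rank_le hU hI h0 (measurable_prodMk_left hE) (hle v)


/-! ## Outcomes of strategy profiles -/

/-- The game does not bound wages, whereas `WageRestriction` asks for a constant in `[0, 1]`. A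
negative constant, or one above `1` with non-negative profit, is possible only if almost nobody is
hired, and then the constant `0` works vacuously. -/
lemma PaysConstant.exists_mem_Icc {M : Market} {O : FirmOutcome}
    (hO : IsFirmOutcome M .noEPSW O) {c : ℝ} (hc : PaysConstant O c) (hp : 0 ≤ profit M O) :
    ∃ c ∈ Set.Icc (0 : ℝ) 1, PaysConstant O c := by
  by_cases h0 : c < 0
  · refine ⟨0, by simp, fun g => (hc g).mono fun v hv hf => ?_⟩
    have := hO.w_nonneg g v
    linarith [hv hf]
  by_cases h1 : c ≤ 1
  · exact ⟨c, ⟨not_lt.mp h0, h1⟩, hc⟩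
  have hint := hO.integrable_of_profit_nonneg hp
  have hle : ∀ g, ∀ᵐ v, profitDensity O g v ≤ 0 := fun g => by
    filter_upwards [hc g] with v hv
    rcases (hO.f_nonneg g v).eq_or_lt with hf | hf
    · simp [profitDensity, ← hf]
    · rw [profitDensity, hv hf]
      have := v.val_le_one
      exact mul_nonpos_of_nonpos_of_nonneg (by linarith) hf.le
  have hile : ∀ g, ∫ v, profitDensity O g v ≤ 0 := fun g => integral_nonpos_of_ae (hle g)
  rw [profit_of_integrable M hint, ← EReal.coe_zero, EReal.coe_le_coe_iff] at hp
  have hA : ∫ v, profitDensity O .A v = 0 := by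
    refine le_antisymm (hile _) ?_
    by_contra hcon
    nlinarith [hile .B, M.β_pos]
  have hB : ∫ v, profitDensity O .B v = 0 := by
    refine le_antisymm (hile _) ?_
    rwa [hA, mul_zero, zero_add] at hp
  refine ⟨0, by simp, fun g => ?_⟩
  have hz : ∫ v, profitDensity O g v = 0 := by
    cases g
    · exact hA
    · exact hB
  have hae := (integral_eq_zero_iff_of_nonneg_ae (f := fun v => -profitDensity O g v)
    ((hle g).mono fun v hv => neg_nonneg.mpr hv) (hint g).neg).mp (by rw [integral_neg, hz, neg_zero])
  filter_upwards [hae, hc g] with v hv hcv hf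
  have := v.val_le_one
  simp only [profitDensity, hcv hf, Pi.zero_apply, neg_eq_zero, mul_eq_zero, hf.ne', or_false] at hv
  linarith

section Game

variable [MeasurableSpace Index] {M : Market} {μw : WorkerGroup → Measure Index}
  {r : Regime} {a : Firm → Announcement} {σ : WorkerStrategies} {i j : Firm} {g : WorkerGroup}

/-- Each worker's decision is optimal after every pair of announcements. -/
def OptimalChoices (σ : WorkerStrategies) : Prop :=
  ∀ (b : Firm → Announcement) (g : WorkerGroup) (x : Worker) (d : Option Firm),
    Available (offers b g x) d →
      workerPayoff (offers b g x) d ≤ workerPayoff (offers b g x) (σ.choice g x (offers b g x))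

lemma offers_of_mem {x : Worker} (hx : x ∈ (a i).S g) : offers a g x i = some ((a i).w g x) :=
  if_pos hx

lemma offers_of_notMem {x : Worker} (hx : x ∉ (a i).S g) : offers a g x i = none :=
  if_neg hx

lemma workerPayoff_of_mem {x : Worker} (hx : x ∈ (a i).S g) :
    workerPayoff (offers a g x) (some i) = (a i).w g x := by
  simp [workerPayoff, offers_of_mem hx]

lemma available_of_mem {x : Worker} (hx : x ∈ (a i).S g) : Available (offers a g x) (some i) := by
  simp [Available, offers_of_mem hx]

lemma mem_of_mem_hired {x : Worker} (hx : x ∈ hired a σ i g) : x ∈ (a i).S g := by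
  have h := σ.available g x (offers a g x)
  rw [show σ.choice g x (offers a g x) = some i from hx] at h
  by_contra hcon
  simp [Available, offers_of_notMem hcon] at h

lemma disjoint_hired (hij : i ≠ j) : Disjoint (hired a σ i g) (hired a σ j g) := by
  rw [Set.disjoint_left]
  intro x hx hx'
  exact hij (Option.some_injective _ (Eq.trans (Eq.symm hx) hx'))

lemma Announcement.w_eq (A : Announcement) {x y : Worker} (hx : x ∈ A.S g) (hy : y ∈ A.S g)
    (h : x.1 = y.1) : A.w g x = A.w g y :=
  le_antisymm (A.monotone g y hy x hx h.le) (A.monotone g x hx y hy h.ge)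

lemma OptimalChoices.nonneg (hσ : OptimalChoices σ) {x : Worker} (hx : x ∈ hired a σ i g) :
    0 ≤ (a i).w g x := by
  have h := hσ a g x none trivial
  rw [show σ.choice g x (offers a g x) = some i from hx,
    workerPayoff_of_mem (mem_of_mem_hired hx)] at h
  exact h

lemma OptimalChoices.le_of_mem (hσ : OptimalChoices σ) {x : Worker} (hx : x ∈ hired a σ i g)
    (hj : x ∈ (a j).S g) : (a j).w g x ≤ (a i).w g x := by
  have h := hσ a g x (some j) (available_of_mem hj)
  rwa [show σ.choice g x (offers a g x) = some i from hx,
    workerPayoff_of_mem (mem_of_mem_hired hx), workerPayoff_of_mem hj] at h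

lemma OptimalChoices.nonpos_of_unassigned (hσ : OptimalChoices σ) {x : Worker}
    (hx : ∀ i, x ∉ hired a σ i g) (hj : x ∈ (a j).S g) : (a j).w g x ≤ 0 := by
  have h := hσ a g x (some j) (available_of_mem hj)
  rw [workerPayoff_of_mem hj] at h
  cases hc : σ.choice g x (offers a g x) with
  | none => rwa [hc] at h
  | some i => exact absurd hc (hx i)

lemma paidWage_eq {v : Productivity} {t : Index} (h : 0 < hiredDensity M μw a σ i g v)
    (ht : (v, t) ∈ hired a σ i g) : paidWage M μw a σ i g v = (a i).w g (v, t) := by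
  have hex : 0 < hiredDensity M μw a σ i g v ∧ ∃ t, (v, t) ∈ hired a σ i g := ⟨h, t, ht⟩
  rw [paidWage, dif_pos hex]
  exact (a i).w_eq (mem_of_mem_hired hex.2.choose_spec) (mem_of_mem_hired ht) rfl

lemma paidWage_eq_zero {v : Productivity} (h : ¬ 0 < hiredDensity M μw a σ i g v) :
    paidWage M μw a σ i g v = 0 :=
  dif_neg fun hex => h hex.1

lemma exists_mem_of_hiredDensity_pos {v : Productivity} (h : 0 < hiredDensity M μw a σ i g v) :
    ∃ t, (v, t) ∈ hired a σ i g := by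
  by_contra! hcon
  have : {t | (v, t) ∈ hired a σ i g} = ∅ := eq_empty_of_forall_notMem hcon
  simp [hiredDensity, this] at h

lemma hiredDensity_nonneg (v : Productivity) : 0 ≤ hiredDensity M μw a σ i g v :=
  mul_nonneg (M.f_pos g v).le ENNReal.toReal_nonneg

lemma OptimalChoices.paidWage_nonneg (hσ : OptimalChoices σ) (v : Productivity) :
    0 ≤ paidWage M μw a σ i g v := by
  by_cases h : 0 < hiredDensity M μw a σ i g v
  · obtain ⟨t, ht⟩ := exists_mem_of_hiredDensity_pos h
    rw [paidWage_eq h ht]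
    exact hσ.nonneg ht
  · rw [paidWage_eq_zero h]

lemma paidWage_monotoneOn :
    MonotoneOn (paidWage M μw a σ i g) {v | 0 < hiredDensity M μw a σ i g v} := by
  intro v hv v' hv' hle
  obtain ⟨t, ht⟩ := exists_mem_of_hiredDensity_pos hv
  obtain ⟨t', ht'⟩ := exists_mem_of_hiredDensity_pos hv'
  rw [paidWage_eq hv ht, paidWage_eq hv' ht']
  exact (a i).monotone g _ (mem_of_mem_hired ht') _ (mem_of_mem_hired ht) hle

lemma measurableSet_hired_of_firmPayoff (h : 0 ≤ firmPayoff M μw r a σ i) :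
    (∀ g, MeasurableSet (hired a σ i g)) ∧ ¬ Violates M μw a σ i r := by
  by_contra hcon
  rw [firmPayoff, if_neg hcon] at h
  exact absurd h (not_le.mpr (by
    rw [← EReal.coe_one, ← EReal.coe_neg, ← EReal.coe_zero, EReal.coe_lt_coe_iff]
    norm_num))

variable [∀ g, IsProbabilityMeasure (μw g)]

lemma hiredDensity_pos_iff {v : Productivity} :
    0 < hiredDensity M μw a σ i g v ↔ μw g {t | (v, t) ∈ hired a σ i g} ≠ 0 := by
  rw [hiredDensity, mul_pos_iff_of_pos_left (M.f_pos g v), ENNReal.toReal_pos_iff,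
    pos_iff_ne_zero]
  exact and_iff_left (measure_lt_top _ _)

lemma measurable_hiredDensity (h : MeasurableSet (hired a σ i g)) :
    Measurable (hiredDensity M μw a σ i g) :=
  (M.measurable_f g).mul (measurable_measure_prodMk_left h).ennreal_toReal

lemma measurable_paidWage (h : MeasurableSet (hired a σ i g)) :
    Measurable (paidWage M μw a σ i g) :=
  Productivity.measurable_of_monotoneOn
    (measurableSet_lt measurable_const (measurable_hiredDensity h))
    paidWage_monotoneOn fun _ hv => paidWage_eq_zero hv

lemma setLIntegral_workerMeasure {H : Set Worker} (hH : MeasurableSet H)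
    {ψ : Productivity → ENNReal} (hψ : Measurable ψ) :
    ∫⁻ x in H, ψ x.1 ∂workerMeasure M μw g =
      ∫⁻ v, ψ v * (ENNReal.ofReal (M.f g v) * μw g {t | (v, t) ∈ H}) := by
  have hm : Measurable fun v => μw g {t | (v, t) ∈ H} := measurable_measure_prodMk_left hH
  have hi : Measurable (H.indicator fun x : Worker => ψ x.1) :=
    (hψ.comp measurable_fst).indicator hH
  rw [← lintegral_indicator hH, workerMeasure, lintegral_prod _ hi.aemeasurable]
  have hin : ∀ v, ∫⁻ t, H.indicator (fun x => ψ x.1) (v, t) ∂μw g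
      = ψ v * μw g {t | (v, t) ∈ H} := by
    intro v
    have : (fun t => H.indicator (fun x => ψ x.1) (v, t))
        = {t | (v, t) ∈ H}.indicator fun _ => ψ v := rfl
    rw [this]
    exact lintegral_indicator_const (measurable_prodMk_left hH) _
  simp_rw [hin]
  refine (lintegral_withDensity_eq_lintegral_mul _ (M.measurable_f g).ennreal_ofReal
    (hψ.mul hm)).trans (lintegral_congr fun v => ?_)
  simp only [Pi.mul_apply]
  ring

lemma workerMeasure_pos_iff {H : Set Worker} (hH : MeasurableSet H) :
    0 < workerMeasure M μw g H ↔ 0 < volume {v | μw g {t | (v, t) ∈ H} ≠ 0} := by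
  have h := setLIntegral_workerMeasure (M := M) (μw := μw) (g := g) hH
    (measurable_const (a := (1 : ENNReal)))
  have hm : Measurable fun v => μw g {t | (v, t) ∈ H} := measurable_measure_prodMk_left hH
  have hm' : Measurable fun v => ENNReal.ofReal (M.f g v) * μw g {t | (v, t) ∈ H} :=
    (M.measurable_f g).ennreal_ofReal.mul hm
  rw [setLIntegral_const, one_mul] at h
  simp only [one_mul] at h
  rw [h, lintegral_pos_iff_support hm']
  congr! 2
  ext v
  simp [Function.mem_support, M.f_pos g v]

/-- Fibres of hired workers may be null without being empty, and there `paidWage` takes its default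
value `0`; such workers are negligible by Tonelli. -/
lemma ae_hiredDensity_pos (h : MeasurableSet (hired a σ i g)) :
    ∀ᵐ x ∂(workerMeasure M μw g).restrict (hired a σ i g), 0 < hiredDensity M μw a σ i g x.1 := by
  rw [ae_restrict_iff' h, ae_iff]
  simp only [Classical.not_imp]
  have hm : MeasurableSet {x | x ∈ hired a σ i g ∧ ¬ 0 < hiredDensity M μw a σ i g x.1} :=
    h.inter (measurableSet_lt measurable_const
      ((measurable_hiredDensity h).comp measurable_fst)).compl
  by_contra hne
  rw [← Ne, ← pos_iff_ne_zero, workerMeasure_pos_iff hm] at hne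
  obtain ⟨v, hv⟩ := nonempty_of_measure_ne_zero hne.ne'
  refine hv ?_
  by_cases hd : 0 < hiredDensity M μw a σ i g v
  · simp [hd.not_ge]
  · refine measure_mono_null (fun t ht => ?_) (not_not.mp (mt hiredDensity_pos_iff.mpr hd))
    exact ht.1

lemma extIntegral_hired (h : MeasurableSet (hired a σ i g)) :
    extIntegral ((workerMeasure M μw g).restrict (hired a σ i g))
        (fun x => x.1.val - (a i).w g x) =
      extIntegral volume (profitDensity (gameOutcome M μw a σ i) g) := by
  have hae : (fun x : Worker => x.1.val - (a i).w g x)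
      =ᵐ[(workerMeasure M μw g).restrict (hired a σ i g)]
        fun x => x.1.val - paidWage M μw a σ i g x.1 := by
    filter_upwards [ae_hiredDensity_pos h, ae_restrict_mem h] with x hx hxm
    rw [paidWage_eq hx hxm]
  have hφ : Measurable fun v => v.val - paidWage M μw a σ i g v :=
    Productivity.measurable_val.sub (measurable_paidWage h)
  have key : ∀ φ : Productivity → ℝ, Measurable φ →
      ∫⁻ x in hired a σ i g, ENNReal.ofReal (φ x.1) ∂workerMeasure M μw g
        = ∫⁻ v, ENNReal.ofReal (φ v * hiredDensity M μw a σ i g v) := by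
    intro φ hφ
    rw [setLIntegral_workerMeasure h hφ.ennreal_ofReal]
    refine lintegral_congr fun v => ?_
    rw [ENNReal.ofReal_mul' (hiredDensity_nonneg v), hiredDensity,
      ENNReal.ofReal_mul (M.f_pos g v).le, ENNReal.ofReal_toReal (measure_ne_top _ _)]
  rw [extIntegral_congr hae, extIntegral, extIntegral, key _ hφ]
  congr 2
  have h2 := key _ hφ.neg
  simp only [Pi.neg_apply, neg_mul] at h2
  exact h2

/-- From workers to productivities: take the productivities over which the fibre is non-null.
Conversely, take all hired workers over the given productivities. Wages depend only on productivity,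
so the inequalities carry over. -/
lemma paysDifferently_iff (h : ∀ g, MeasurableSet (hired a σ i g)) {g g' : WorkerGroup} :
    PaysDifferently M μw a σ i g g' ↔ Differs (gameOutcome M μw a σ i) g g' := by
  constructor
  · rintro ⟨T, T', hT, hTs, hT0, hT', hTs', hT0', hne⟩
    have hmem : ∀ {g : WorkerGroup} {T : Set Worker} {v : Productivity}, T ⊆ hired a σ i g →
        μw g {t | (v, t) ∈ T} ≠ 0 →
        0 < hiredDensity M μw a σ i g v ∧ ∃ t, (v, t) ∈ T := by
      intro g T v hTs hv
      exact ⟨hiredDensity_pos_iff.mpr fun h0 => hv (measure_mono_null (fun t ht => hTs ht) h0),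
        nonempty_of_measure_ne_zero hv⟩
    refine ⟨{v | μw g {t | (v, t) ∈ T} ≠ 0}, {v | μw g' {t | (v, t) ∈ T'} ≠ 0},
      (measurable_measure_prodMk_left hT) (measurableSet_singleton 0).compl,
      (workerMeasure_pos_iff hT).mp hT0,
      (measurable_measure_prodMk_left hT') (measurableSet_singleton 0).compl,
      (workerMeasure_pos_iff hT').mp hT0', fun v hv => (hmem hTs hv).1,
      fun v hv => (hmem hTs' hv).1, fun v hv v' hv' => ?_⟩
    obtain ⟨hd, t, ht⟩ := hmem hTs hv
    obtain ⟨hd', t', ht'⟩ := hmem hTs' hv'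
    have := hne _ ht _ ht'
    rwa [← paidWage_eq hd (hTs ht), ← paidWage_eq hd' (hTs' ht')] at this
  · rintro ⟨V, V', hV, hV0, hV', hV0', hVf, hVf', hne⟩
    have hpos : ∀ {g : WorkerGroup} {V : Set Productivity}, MeasurableSet V → 0 < volume V →
        (∀ v ∈ V, 0 < hiredDensity M μw a σ i g v) →
        0 < workerMeasure M μw g (hired a σ i g ∩ Prod.fst ⁻¹' V) := by
      intro g V hV hV0 hVf
      rw [workerMeasure_pos_iff ((h g).inter (measurable_fst hV))]
      refine hV0.trans_le (measure_mono fun v hv => ?_)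
      have := hiredDensity_pos_iff.mp (hVf v hv)
      simpa [hv] using this
    refine ⟨_, _, (h g).inter (measurable_fst hV), inter_subset_left, hpos hV hV0 hVf,
      (h g').inter (measurable_fst hV'), inter_subset_left, hpos hV' hV0' hVf', ?_⟩
    rintro ⟨v, t⟩ ⟨hx, hv⟩ ⟨v', t'⟩ ⟨hy, hv'⟩
    rw [← paidWage_eq (hVf v hv) hx, ← paidWage_eq (hVf' v' hv') hy]
    exact hne v hv v' hv'

lemma firmPayoff_eq_profit (h : ∀ g, MeasurableSet (hired a σ i g))
    (h' : ¬ Violates M μw a σ i r) :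
    firmPayoff M μw r a σ i = profit M (gameOutcome M μw a σ i) := by
  rw [firmPayoff, if_pos ⟨h, h'⟩, extIntegral_hired (h _), extIntegral_hired (h _), profit_eq]

lemma isFirmOutcome_gameOutcome (hσ : OptimalChoices σ) (h : 0 ≤ firmPayoff M μw r a σ i) :
    IsFirmOutcome M r (gameOutcome M μw a σ i) := by
  obtain ⟨hm, hv⟩ := measurableSet_hired_of_firmPayoff h
  have key : ∀ r, WageRestriction (gameOutcome M μw a σ i) r →
      IsFirmOutcome M r (gameOutcome M μw a σ i) := by
    intro r hr
    refine ⟨fun g => measurable_hiredDensity (hm g), fun g => measurable_paidWage (hm g),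
      fun g v => hiredDensity_nonneg v, fun g v => ?_, fun g v => hσ.paidWage_nonneg v,
      fun g v hv => paidWage_eq_zero (not_lt_of_ge (le_of_eq hv)), fun g v v' hle hv => ?_, hr⟩
    · refine mul_le_of_le_one_right (M.f_pos g v).le ?_
      exact ENNReal.toReal_le_of_le_ofReal zero_le_one (by simpa using prob_le_one)
    · by_cases hv' : 0 < hiredDensity M μw a σ i g v'
      · exact paidWage_monotoneOn hv' hv hle
      · exact (paidWage_eq_zero hv').trans_le (hσ.paidWage_nonneg v)
  refine key r ?_
  -- Measurability, which the other two regimes need, is read off from the regime without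
  -- restriction.
  have hmeas := (key .noEPSW trivial).isMeasurable
  cases r with
  | noEPSW => trivial
  | groupBased =>
    exact (wageRestriction_groupBased_iff hmeas).mpr fun g g' hne hd =>
      hv ⟨g, g', hne, (paysDifferently_iff hm).mpr hd⟩
  | nonGroupBased =>
    obtain ⟨c, hc⟩ := exists_paysConstant_of_forall_not_differs hmeas fun g g' hd =>
      hv ⟨g, g', (paysDifferently_iff hm).mpr hd⟩
    rw [firmPayoff_eq_profit hm hv] at h
    exact hc.exists_mem_Icc (key .noEPSW trivial) h

lemma firmPayoff_eq_profit_of_nonneg (h : 0 ≤ firmPayoff M μw r a σ i) :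
    firmPayoff M μw r a σ i = profit M (gameOutcome M μw a σ i) := by
  obtain ⟨hm, hv⟩ := measurableSet_hired_of_firmPayoff h
  exact firmPayoff_eq_profit hm hv

end Game


/-! ## Equilibrium outcomes are core outcomes -/

lemma Firm.other_ne (i : Firm) : i.other ≠ i := by
  cases i <;> simp [Firm.other]

lemma Firm.eq_or_eq_other (i j : Firm) : j = i ∨ j = i.other := by
  cases i <;> cases j <;> simp [Firm.other]

lemma Firm.other_other (i : Firm) : i.other.other = i := by
  cases i <;> rfl

lemma IsOutcome.feasible' {M : Market} {r : Regime} {O : Firm → FirmOutcome}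
    (hO : IsOutcome M r O) (j : Firm) (g : WorkerGroup) (v : Productivity) :
    (O j).f g v + (O j.other).f g v ≤ M.f g v := by
  cases j with
  | one => exact hO.feasible g v
  | two => exact (add_comm _ _).trans_le (hO.feasible g v)

lemma Differs.of_ae_shift {O O' : FirmOutcome} {ε : ℝ}
    (h : ∀ g, ∀ᵐ v, 0 < O.f g v → 0 < O'.f g v ∧ O.w g v = O'.w g v + ε)
    {g g' : WorkerGroup} (hd : Differs O g g') : Differs O' g g' := by
  obtain ⟨V, V', hV, hV0, hV', hV0', hVf, hVf', hne⟩ := hd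
  obtain ⟨N, hN, hNm, hN0⟩ := exists_measurable_superset_of_null (ae_iff.mp (h g))
  obtain ⟨N', hN', hNm', hN0'⟩ := exists_measurable_superset_of_null (ae_iff.mp (h g'))
  have key : ∀ v ∈ V \ N, 0 < O'.f g v ∧ O.w g v = O'.w g v + ε := fun v hv => by
    by_contra hcon
    exact hv.2 (hN fun h => hcon (h (hVf v hv.1)))
  have key' : ∀ v ∈ V' \ N', 0 < O'.f g' v ∧ O.w g' v = O'.w g' v + ε := fun v hv => by
    by_contra hcon
    exact hv.2 (hN' fun h => hcon (h (hVf' v hv.1)))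
  refine ⟨V \ N, V' \ N', hV.diff hNm, by rwa [measure_sdiff_null hN0], hV'.diff hNm',
    by rwa [measure_sdiff_null hN0'], fun v hv => (key v hv).1, fun v hv => (key' v hv).1,
    fun v hv v' hv' heq => hne v hv.1 v' hv'.1 ?_⟩
  rw [(key v hv).2, (key' v' hv').2, heq]

lemma profitDensity_ae_shift {O O' : FirmOutcome} {g : WorkerGroup} {ε : ℝ} (hf : ∀ v, 0 ≤ O'.f g v)
    (h : ∀ᵐ v, O.f g v = O'.f g v ∧ (0 < O'.f g v → O.w g v = O'.w g v + ε)) :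
    profitDensity O g =ᵐ[volume] fun v => profitDensity O' g v - ε * O'.f g v := by
  filter_upwards [h] with v hv
  rcases (hf v).eq_or_lt with h0 | h0
  · simp [profitDensity, hv.1, ← h0]
  · rw [profitDensity, profitDensity, hv.1, hv.2 h0]
    ring

lemma IsFirmOutcome.integrable_f {M : Market} {r : Regime} {O : FirmOutcome}
    (hO : IsFirmOutcome M r O) (g : WorkerGroup) :
    Integrable (O.f g) := by
  obtain ⟨C, hC⟩ := M.upper g
  refine Integrable.of_bound (hO.measurable_f g).aestronglyMeasurable C
    (Filter.Eventually.of_forall fun v => ?_)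
  rw [Real.norm_of_nonneg (hO.f_nonneg g v)]
  exact (hO.f_le g v).trans (hC v)

section Game

variable [MeasurableSpace Index] {M : Market} {μw : WorkerGroup → Measure Index}
  {r : Regime} {a : Firm → Announcement} {σ : WorkerStrategies} {i j : Firm} {g : WorkerGroup}

/-- The announcement that makes no offers. -/
def Announcement.empty : Announcement where
  S _ := ∅
  w _ _ := 0
  measurable_S _ := MeasurableSet.empty
  measurable_w _ := measurable_const
  monotone _ _ hx := hx.elim

lemma firmPayoff_update_empty :
    firmPayoff M μw r (Function.update a i Announcement.empty) σ i = 0 := by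
  have h : ∀ g, hired (Function.update a i Announcement.empty) σ i g = ∅ := fun g =>
    eq_empty_of_forall_notMem fun x hx => by
      have := mem_of_mem_hired hx
      rw [Function.update_self] at this
      exact this
  have hp : ∀ g g', ¬ PaysDifferently M μw (Function.update a i Announcement.empty) σ i g g' := by
    rintro g g' ⟨T, -, -, hT, hT0, -⟩
    rw [h, subset_empty_iff] at hT
    simp [hT] at hT0
  have hv : ¬ Violates M μw (Function.update a i Announcement.empty) σ i r := by
    cases r with
    | noEPSW => exact id
    | groupBased => exact fun ⟨g, g', _, h⟩ => hp g g' h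
    | nonGroupBased => exact fun ⟨g, g', h⟩ => hp g g' h
  rw [firmPayoff, if_pos ⟨fun g => by rw [h]; exact MeasurableSet.empty, hv⟩, h, h]
  simp [extIntegral_zero_measure]

lemma IsSPNE.firmPayoff_nonneg (h : IsSPNE M μw r a σ) (i : Firm) :
    0 ≤ firmPayoff M μw r a σ i :=
  firmPayoff_update_empty.symm.trans_le (h.2 i Announcement.empty)

/-- The workers of group `g` who receive no offer from firm `k` that is at least as good as the
wage `w`, a function of productivity. -/
def attractable (a : Firm → Announcement) (k : Firm) (g : WorkerGroup) (w : Productivity → ℝ) :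
    Set Worker :=
  {x | x ∈ (a k).S g → (a k).w g x < w x.1}

lemma measurableSet_attractable {w : Productivity → ℝ} (hw : Measurable w) :
    MeasurableSet (attractable a i g w) := by
  have h : MeasurableSet (Subtype.val '' {x : (a i).S g | w x.1.1 ≤ (a i).w g x}) :=
    ((a i).measurable_S g).subtype_image
      (measurableSet_le (hw.comp (measurable_fst.comp measurable_subtype_coe))
        ((a i).measurable_w g))
  have heq : attractable a i g w = (Subtype.val '' {x : (a i).S g | w x.1.1 ≤ (a i).w g x})ᶜ := by
    ext x
    simp only [attractable, mem_ofPred_eq, mem_compl_iff, mem_image, Subtype.exists, exists_and_left,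
      exists_prop, exists_eq_right_right, not_and]
    exact ⟨fun h hx hx' => not_le_of_gt (h hx') hx, fun h hx => by
      by_contra hcon
      exact h (not_lt.mp hcon) hx⟩
  rw [heq]
  exact h.compl

variable [∀ g, IsProbabilityMeasure (μw g)]

/-- Adding the same `ε` to all wages creates no new differences. The common wage may leave `[0, 1]`,
but the rule of the game only compares wages. -/
lemma not_violates_of_ae_shift {O : FirmOutcome} (hO : O.IsMeasurable)
    (hr : WageRestriction O r) (hm : ∀ g, MeasurableSet (hired a σ i g)) {ε : ℝ}
    (h : ∀ g, ∀ᵐ v, 0 < (gameOutcome M μw a σ i).f g v →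
      0 < O.f g v ∧ (gameOutcome M μw a σ i).w g v = O.w g v + ε) :
    ¬ Violates M μw a σ i r := by
  cases r with
  | noEPSW => exact id
  | groupBased =>
    rintro ⟨g, g', hgg', hp⟩
    exact (wageRestriction_groupBased_iff hO).mp hr g g' hgg'
      (((paysDifferently_iff hm).mp hp).of_ae_shift h)
  | nonGroupBased =>
    rintro ⟨g, g', hp⟩
    obtain ⟨c, -, hc⟩ := hr
    exact PaysConstant.not_differs hc g g' (((paysDifferently_iff hm).mp hp).of_ae_shift h)

lemma hiredDensity_add_le (hm : ∀ i, MeasurableSet (hired a σ i g)) (v : Productivity) :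
    hiredDensity M μw a σ .one g v + hiredDensity M μw a σ .two g v ≤ M.f g v := by
  have hd : Disjoint {t | (v, t) ∈ hired a σ .one g} {t | (v, t) ∈ hired a σ .two g} :=
    (disjoint_hired (by simp)).preimage (Prod.mk v)
  rw [hiredDensity, hiredDensity, ← mul_add, ← ENNReal.toReal_add (measure_ne_top _ _)
    (measure_ne_top _ _), ← measure_union hd (measurable_prodMk_left (hm .two))]
  refine mul_le_of_le_one_right (M.f_pos g v).le ?_
  exact ENNReal.toReal_le_of_le_ofReal zero_le_one (by simpa using prob_le_one)

lemma isOutcome_gameOutcome (hσ : OptimalChoices σ) (h : ∀ i, 0 ≤ firmPayoff M μw r a σ i) :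
    IsOutcome M r (gameOutcome M μw a σ) where
  firm i := isFirmOutcome_gameOutcome hσ (h i)
  feasible g v := hiredDensity_add_le
    (fun i => (measurableSet_hired_of_firmPayoff (h i)).1 g) v

/-- A worker outside `attractable` has an offer of at least `w v > 0` from the rival, so she is
employed by one of the firms at that wage or more. Only firms whose paid wage at `v` reaches `w v`
therefore reduce the supply, each by at most what it hires. -/
lemma le_measure_attractable (hσ : OptimalChoices σ)
    {w : Productivity → ℝ} (hw : Measurable w) {v : Productivity} (hpos : 0 < w v) {y : ℝ}
    (hy : y + ((if w v ≤ paidWage M μw a σ j g v then hiredDensity M μw a σ j g v else 0) +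
      (if w v ≤ paidWage M μw a σ j.other g v then hiredDensity M μw a σ j.other g v else 0))
        ≤ M.f g v) :
    ENNReal.ofReal (y / M.f g v) ≤ μw g {t | (v, t) ∈ attractable a j.other g w} := by
  classical
  let H : Firm → Set Index := fun i => {t | (v, t) ∈ hired a σ i g}
  let c : Firm → ENNReal := fun i => if w v ≤ paidWage M μw a σ i g v then μw g (H i) else 0
  have hbad : ∀ i, μw g {t | (v, t) ∈ hired a σ i g ∧ w v ≤ (a i).w g (v, t)} ≤ c i := by
    intro i
    by_cases hd : 0 < hiredDensity M μw a σ i g v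
    · by_cases hwi : w v ≤ paidWage M μw a σ i g v
      · simp only [c, if_pos hwi]
        exact measure_mono fun t ht => ht.1
      · refine (measure_mono_null (t := ∅) (fun t ht => hwi ?_) measure_empty).trans_le zero_le
        rw [paidWage_eq hd ht.1]
        exact ht.2
    · refine (measure_mono_null (fun t ht => ?_)
        (not_not.mp (mt hiredDensity_pos_iff.mpr hd))).trans_le zero_le
      exact ht.1
  have hE : MeasurableSet {t | (v, t) ∈ attractable a j.other g w} :=
    measurable_prodMk_left (measurableSet_attractable hw)
  have hcompl : μw g {t | (v, t) ∈ attractable a j.other g w}ᶜ ≤ c j + c j.other := by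
    refine le_trans (measure_mono fun t ht => ?_)
      ((measure_union_le _ _).trans (add_le_add (hbad j) (hbad j.other)))
    simp only [attractable, mem_compl_iff, mem_ofPred_eq, Classical.not_imp, not_lt] at ht
    obtain ⟨hS, hle⟩ := ht
    by_cases h1 : (v, t) ∈ hired a σ j g
    · exact Or.inl ⟨h1, hle.trans (hσ.le_of_mem h1 hS)⟩
    by_cases h2 : (v, t) ∈ hired a σ j.other g
    · exact Or.inr ⟨h2, hle⟩
    · refine absurd (hσ.nonpos_of_unassigned (fun i => ?_) hS) (not_le.mpr (hpos.trans_le hle))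
      rcases j.eq_or_eq_other i with rfl | rfl
      · exact h1
      · exact h2
  have hc : ∀ i, M.f g v * (c i).toReal =
      if w v ≤ paidWage M μw a σ i g v then hiredDensity M μw a σ i g v else 0 := by
    intro i
    by_cases hwi : w v ≤ paidWage M μw a σ i g v
    · simp only [c, if_pos hwi]
      rfl
    · simp only [c, if_neg hwi, ENNReal.toReal_zero, mul_zero]
  have hctop : ∀ i, c i ≠ ⊤ := fun i => by
    simp only [c]
    split_ifs
    · exact measure_ne_top _ _
    · exact ENNReal.zero_ne_top
  rw [prob_compl_eq_one_sub hE] at hcompl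
  have h1 := ENNReal.toReal_mono (ENNReal.add_ne_top.mpr ⟨hctop _, hctop _⟩) hcompl
  rw [ENNReal.toReal_sub_of_le prob_le_one ENNReal.one_ne_top, ENNReal.toReal_one,
    ENNReal.toReal_add (hctop _) (hctop _)] at h1
  refine ENNReal.ofReal_le_of_le_toReal ?_
  rw [div_le_iff₀ (M.f_pos g v)]
  rw [← hc, ← hc] at hy
  nlinarith [M.f_pos g v]

lemma exists_deviation (hna : ∀ g, NonAtomic (μw g)) (hσ : OptimalChoices σ)
    {O' : FirmOutcome} (hO' : IsFirmOutcome M r O')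
    (hblock : ∀ g, ∀ᵐ v,
      (paidWage M μw a σ j g v ≤ O'.w g v ∧ paidWage M μw a σ j.other g v < O'.w g v) ∨
      (paidWage M μw a σ j g v ≤ O'.w g v ∧
        O'.f g v + hiredDensity M μw a σ j.other g v ≤ M.f g v) ∨
      (paidWage M μw a σ j.other g v < O'.w g v ∧
        O'.f g v + hiredDensity M μw a σ j g v ≤ M.f g v) ∨
      (O'.f g v + hiredDensity M μw a σ j g v + hiredDensity M μw a σ j.other g v ≤ M.f g v))
    {ε : ℝ} (hε : 0 < ε) :
    ∃ a' : Announcement, (∀ g, MeasurableSet (hired (Function.update a j a') σ j g)) ∧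
      ∀ g, ∀ᵐ v, hiredDensity M μw (Function.update a j a') σ j g v = O'.f g v ∧
        (0 < O'.f g v → paidWage M μw (Function.update a j a') σ j g v = O'.w g v + ε) := by
  have hwm : ∀ g, Measurable fun v => O'.w g v + ε := fun g => (hO'.measurable_w g).add_const ε
  -- Restricting to positive `O'.f` makes the offers monotone: outcomes control lower wages only
  -- from types that are hired.
  let E : WorkerGroup → Set Worker := fun g =>
    attractable a j.other g (fun v => O'.w g v + ε) ∩ {x | 0 < O'.f g x.1}
  have hE : ∀ g, MeasurableSet (E g) := fun g => (measurableSet_attractable (hwm g)).inter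
    (measurableSet_lt measurable_const ((hO'.measurable_f g).comp measurable_fst))
  -- The minimum makes the density admissible at every `v`; by `hle` below it is the first term
  -- almost everywhere.
  let ρ : WorkerGroup → Productivity → ENNReal := fun g v =>
    min (ENNReal.ofReal (O'.f g v / M.f g v)) (μw g {t | (v, t) ∈ E g})
  have hρ : ∀ g, Measurable (ρ g) := fun g =>
    ((hO'.measurable_f g).div (M.measurable_f g)).ennreal_ofReal.min
      (measurable_measure_prodMk_left (hE g))
  choose S hSE hSm hSρ using fun g => exists_measurable_sections (hna g) (hE g) (hρ g)
    fun v => min_le_right _ _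
  let a' : Announcement :=
    { S := S
      w := fun g x => O'.w g x.1 + ε
      measurable_S := hSm
      measurable_w := fun g => (hwm g).comp (measurable_fst.comp measurable_subtype_coe)
      monotone := fun g x hx y _ hle =>
        add_le_add_left (hO'.monotone g x.1 y.1 hle (hSE g hx).2) ε }
  have hself : Function.update a j a' j = a' := Function.update_self _ _ _
  have hother : Function.update a j a' j.other = a j.other :=
    Function.update_of_ne j.other_ne _ _
  have hhired : ∀ g, hired (Function.update a j a') σ j g = S g := by
    intro g
    ext x
    constructor
    · intro hx
      have := mem_of_mem_hired hx
      rwa [hself] at this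
    · intro hx
      have hxS : x ∈ (Function.update a j a' j).S g := by rwa [hself]
      have hopt := hσ (Function.update a j a') g x (some j) (available_of_mem hxS)
      rw [workerPayoff_of_mem hxS, hself] at hopt
      have hav := σ.available g x (offers (Function.update a j a') g x)
      change σ.choice g x (offers (Function.update a j a') g x) = some j
      cases hc : σ.choice g x (offers (Function.update a j a') g x) with
      | none =>
        rw [hc] at hopt
        have : O'.w g x.1 + ε ≤ 0 := hopt
        linarith [hO'.w_nonneg g x.1]
      | some k =>
        rcases j.eq_or_eq_other k with rfl | rfl
        · rfl
        · rw [hc] at hopt hav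
          have hxk : x ∈ (a j.other).S g := by
            by_contra hcon
            rw [← hother] at hcon
            simp [Available, offers_of_notMem hcon] at hav
          rw [workerPayoff_of_mem (by rwa [hother]), hother] at hopt
          exact absurd hopt (not_le.mpr ((hSE g hx).1 hxk))
  refine ⟨a', fun g => by rw [hhired]; exact hSm g, fun g => ?_⟩
  filter_upwards [hblock g] with v hv
  have hle : ENNReal.ofReal (O'.f g v / M.f g v) ≤ μw g {t | (v, t) ∈ E g} := by
    by_cases hf : 0 < O'.f g v
    · have hEv : {t | (v, t) ∈ E g}
          = {t | (v, t) ∈ attractable a j.other g (fun v => O'.w g v + ε)} := by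
        ext t
        simp [E, hf]
      rw [hEv]
      refine le_measure_attractable (M := M) hσ (hwm g)
        (by linarith [hO'.w_nonneg g v]) ?_
      have h1 := hiredDensity_nonneg (M := M) (μw := μw) (a := a) (σ := σ) (i := j) (g := g) v
      have h2 := hiredDensity_nonneg (M := M) (μw := μw) (a := a) (σ := σ) (i := j.other) (g := g) v
      have h3 := hO'.f_le g v
      -- A paid wage of at most `O'.w g v` is strictly below `O'.w g v + ε`, so the term of that
      -- firm drops out; the four alternatives say which terms remain and that these fit into the
      -- supply.
      rcases hv with ⟨hv1, hv2⟩ | ⟨hv1, hv2⟩ | ⟨hv1, hv2⟩ | hv <;> split_ifs <;> linarith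
    · rw [le_antisymm (not_lt.mp hf) (hO'.f_nonneg g v)]
      simp
  have hmeas : μw g {t | (v, t) ∈ S g} = ENNReal.ofReal (O'.f g v / M.f g v) := by
    rw [hSρ]
    exact min_eq_left hle
  have hden : hiredDensity M μw (Function.update a j a') σ j g v = O'.f g v := by
    rw [hiredDensity, hhired, hmeas, ENNReal.toReal_ofReal
      (div_nonneg (hO'.f_nonneg g v) (M.f_pos g v).le), mul_div_cancel₀ _ (M.f_pos g v).ne']
  refine ⟨hden, fun hf => ?_⟩
  have hd := hden.symm ▸ hf
  obtain ⟨t, ht⟩ := exists_mem_of_hiredDensity_pos hd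
  rw [paidWage_eq hd ht, hself]

theorem IsSPNE.isCoreOutcome (hna : ∀ g, NonAtomic (μw g)) (h : IsSPNE M μw r a σ) :
    IsCoreOutcome M r (gameOutcome M μw a σ) := by
  have hσ : OptimalChoices σ := h.1
  have h0 := h.firmPayoff_nonneg
  have hout := isOutcome_gameOutcome hσ h0
  refine ⟨hout, ?_⟩
  rintro ⟨j, O', hO', hprofit, hblock⟩
  have hpj := firmPayoff_eq_profit_of_nonneg (h0 j)
  have hp0 : 0 ≤ profit M (gameOutcome M μw a σ j) := hpj ▸ h0 j
  have hint := hO'.integrable_of_profit_nonneg (hp0.trans hprofit.le)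
  have hintf := hO'.integrable_f
  have hintj := (hout.firm j).integrable_of_profit_nonneg hp0
  set K := M.β * (∫ v, O'.f .A v) + ∫ v, O'.f .B v with hK
  have hK0 : 0 ≤ K := add_nonneg (mul_nonneg M.β_pos.le (integral_nonneg (hO'.f_nonneg _)))
    (integral_nonneg (hO'.f_nonneg _))
  have hprofit' := hprofit
  rw [profit_of_integrable M hint, profit_of_integrable M hintj, EReal.coe_lt_coe_iff] at hprofit'
  set p' := M.β * (∫ v, profitDensity O' .A v) + ∫ v, profitDensity O' .B v
  set p := M.β * (∫ v, profitDensity (gameOutcome M μw a σ j) .A v) +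
    ∫ v, profitDensity (gameOutcome M μw a σ j) .B v with hp
  -- The raise costs `ε * K`, with `K` the mass hired under `O'`; this choice of `ε` leaves a net
  -- gain of exactly `ε`.
  have hε : 0 < (p' - p) / (K + 1) := div_pos (sub_pos.mpr hprofit') (by linarith)
  set ε := (p' - p) / (K + 1) with hεdef
  have hεK : ε * (K + 1) = p' - p := div_mul_cancel₀ _ (by linarith)
  obtain ⟨a', hm', hae⟩ := exists_deviation hna hσ hO' hblock hε
  have hv' : ¬ Violates M μw (Function.update a j a') σ j r :=
    not_violates_of_ae_shift hO'.isMeasurable hO'.restriction hm' (ε := ε) fun g => by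
      filter_upwards [hae g] with v hv hf
      have hf' : 0 < O'.f g v := hv.1 ▸ hf
      exact ⟨hf', hv.2 hf'⟩
  have hdens := fun g => profitDensity_ae_shift
    (O := gameOutcome M μw (Function.update a j a') σ j) (hO'.f_nonneg g) (hae g)
  have hdev := h.2 j a'
  rw [firmPayoff_eq_profit hm' hv', hpj, profit_of_integrable M hintj, profit_of_integrable M
    (fun g => ((hint g).sub ((hintf g).const_mul ε)).congr (hdens g).symm),
    EReal.coe_le_coe_iff, integral_congr_ae (hdens .A), integral_congr_ae (hdens .B),
    integral_sub (hint _) ((hintf _).const_mul ε), integral_sub (hint _) ((hintf _).const_mul ε),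
    integral_const_mul, integral_const_mul] at hdev
  have : p' - ε * K ≤ p := by
    calc p' - ε * K = _ := by rw [hK]; ring
      _ ≤ p := hdev
  nlinarith

end Game


/-! ## Modifying the outcome of a firm in one group -/

instance : DecidableEq WorkerGroup := Classical.decEq _

/-- The outcome `O`, with the hiring density and the wages in the group `g` replaced. -/
def FirmOutcome.replace (O : FirmOutcome) (g : WorkerGroup) (f w : Productivity → ℝ) :
    FirmOutcome :=
  ⟨Function.update O.f g f, Function.update O.w g w⟩

section Replace

variable {O : FirmOutcome} {g g' : WorkerGroup} {f w : Productivity → ℝ}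

@[simp] lemma FirmOutcome.replace_f_self : (O.replace g f w).f g = f := Function.update_self ..

@[simp] lemma FirmOutcome.replace_w_self : (O.replace g f w).w g = w := Function.update_self ..

lemma FirmOutcome.replace_f_of_ne (h : g' ≠ g) : (O.replace g f w).f g' = O.f g' :=
  Function.update_of_ne h ..

lemma FirmOutcome.replace_w_of_ne (h : g' ≠ g) : (O.replace g f w).w g' = O.w g' :=
  Function.update_of_ne h ..

lemma FirmOutcome.IsMeasurable.replace (hO : O.IsMeasurable) (hf : Measurable f)
    (hw : Measurable w) : (O.replace g f w).IsMeasurable := by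
  constructor <;> intro g' <;> by_cases h : g' = g
  · subst h; simpa
  · simpa only [FirmOutcome.replace_f_of_ne h] using hO.f g'
  · subst h; simpa
  · simpa only [FirmOutcome.replace_w_of_ne h] using hO.w g'

end Replace

lemma WageRestriction.of_ae_sub {O O' : FirmOutcome} {r : Regime} (hO : O.IsMeasurable)
    (hO' : O'.IsMeasurable) (hr : WageRestriction O r)
    (h : ∀ g, ∀ᵐ v, 0 < O'.f g v → 0 < O.f g v ∧ O'.w g v = O.w g v) : WageRestriction O' r := by
  cases r with
  | noEPSW => trivial
  | groupBased =>
    refine (wageRestriction_groupBased_iff hO').mpr fun g g' hgg' hd => ?_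
    exact (wageRestriction_groupBased_iff hO).mp hr g g' hgg'
      (hd.of_ae_shift (ε := 0) (by simpa using h))
  | nonGroupBased =>
    obtain ⟨c, hc, hcc⟩ := hr
    refine ⟨c, hc, fun g => ?_⟩
    filter_upwards [h g, hcc g] with v h1 h2 h3
    rw [(h1 h3).2, h2 (h1 h3).1]

/-- Either the firm hires nobody in the group `g`, or the regime does not restrict its wages in
this group, or it pays a constant wage and may hire anybody at this wage. -/
lemma IsFirmOutcome.restriction_cases {M : Market} {r : Regime} {O : FirmOutcome}
    (hO : IsFirmOutcome M r O) (g : WorkerGroup) :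
    HiresNone O g ∨
      (∀ f w, Measurable f → Measurable w → WageRestriction (O.replace g f w) r) ∨
      ∃ c, PaysConstant O c ∧
        ∀ O' : FirmOutcome, O'.IsMeasurable → PaysConstant O' c → WageRestriction O' r := by
  have hr := hO.restriction
  have hm := hO.isMeasurable
  cases r with
  | noEPSW => exact Or.inr (Or.inl fun _ _ _ _ => trivial)
  | nonGroupBased =>
    obtain ⟨c, hc, hcc⟩ := hr
    exact Or.inr (Or.inr ⟨c, hcc, fun O' _ h => ⟨c, hc, h⟩⟩)
  | groupBased =>
    rcases hiresNone_or_paysConstant_of_not_differs hm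
      ((wageRestriction_groupBased_iff hm).mp hr .A .B (by simp)) with ⟨g', hg'⟩ | ⟨c, hc⟩
    · rcases g.eq_or_eq_other g' with rfl | rfl
      · exact Or.inl hg'
      -- The firm hires almost nobody in the other group, so there is no cross-group comparison to
      -- violate.
      refine Or.inr (Or.inl fun f w hf hw => (wageRestriction_groupBased_iff
        (hm.replace hf hw)).mpr fun g₁ g₂ hne hd => ?_)
      have hnone : HiresNone (O.replace g f w) g.other := by
        rwa [HiresNone, FirmOutcome.replace_f_of_ne g.other_ne]
      rcases g.eq_or_eq_other g₁ with rfl | rfl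
      · rw [(g₁.eq_or_eq_other g₂).resolve_left hne.symm] at hd
        exact hnone.not_differs_left hd.symm
      · exact hnone.not_differs_left hd
    · exact Or.inr (Or.inr ⟨c, hc, fun O' hO' h =>
        (wageRestriction_groupBased_iff hO').mpr fun _ _ _ => h.not_differs _ _⟩)

/-! ## Core outcomes -/

section Core

variable {M : Market} {r : Regime} {O : Firm → FirmOutcome}

/-- Hiring nobody is admissible in every regime and satisfies alternative (4), so a firm making
losses would block. -/
lemma IsCoreOutcome.profit_nonneg (hO : IsCoreOutcome M r O) (j : Firm) : 0 ≤ profit M (O j) := by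
  by_contra hcon
  have hzero : profit M ⟨fun _ _ => 0, fun _ _ => 0⟩ = 0 := by
    simp [profit, extIntegral]
  refine hO.2 ⟨j, ⟨fun _ _ => 0, fun _ _ => 0⟩, ⟨fun _ => measurable_const,
    fun _ => measurable_const, fun _ _ => le_rfl, fun g v => (M.f_pos g v).le, fun _ _ => le_rfl,
    fun _ _ _ => rfl, fun _ _ _ _ _ => le_rfl, ?_⟩, by rw [hzero]; exact not_le.mp hcon,
    fun g => Filter.Eventually.of_forall fun v => Or.inr (Or.inr (Or.inr ?_))⟩
  · cases r with
    | noEPSW => trivial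
    | groupBased =>
      rintro ⟨g, V, -, -, hV0, -, -, hVf, -⟩
      obtain ⟨v, hv⟩ := nonempty_of_measure_ne_zero hV0.ne'
      exact lt_irrefl _ (hVf v hv)
    | nonGroupBased =>
      exact ⟨0, by simp, fun g => Filter.Eventually.of_forall fun v _ => rfl⟩
  · simpa using hO.1.feasible' j g v

lemma IsCoreOutcome.integrable (hO : IsCoreOutcome M r O) (j : Firm) (g : WorkerGroup) :
    Integrable (profitDensity (O j) g) :=
  (hO.1.firm j).integrable_of_profit_nonneg (hO.profit_nonneg j) g

/-- In a core outcome no firm gains from a modification in one group. -/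
lemma IsCoreOutcome.integral_le (hO : IsCoreOutcome M r O) (j : Firm) (g : WorkerGroup)
    {f w : Productivity → ℝ} (hf : Measurable f) (hw : Measurable w) (hf0 : ∀ v, 0 ≤ f v)
    (hfM : ∀ v, f v ≤ M.f g v) (hw0 : ∀ v, 0 ≤ w v) (hfw : ∀ v, f v = 0 → w v = 0)
    (hmono : ∀ v v', v' ≤ v → 0 < f v → w v' ≤ w v)
    (hr : WageRestriction ((O j).replace g f w) r)
    (hblock : ∀ᵐ v, ((O j).w g v ≤ w v ∧ (O j.other).w g v < w v) ∨
      ((O j).w g v ≤ w v ∧ f v + (O j.other).f g v ≤ M.f g v) ∨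
      ((O j.other).w g v < w v ∧ f v + (O j).f g v ≤ M.f g v) ∨
      (f v + (O j).f g v + (O j.other).f g v ≤ M.f g v))
    (hint : Integrable fun v => (v.val - w v) * f v) :
    ∫ v, (v.val - w v) * f v ≤ ∫ v, profitDensity (O j) g v := by
  by_contra! hlt
  have hOj := hO.1.firm j
  have hpd : profitDensity ((O j).replace g f w) g = fun v => (v.val - w v) * f v := by
    ext v
    simp [profitDensity]
  have hpd' : ∀ g' ≠ g, profitDensity ((O j).replace g f w) g' = profitDensity (O j) g' := by
    intro g' hg'
    ext v
    rw [profitDensity, FirmOutcome.replace_f_of_ne hg', FirmOutcome.replace_w_of_ne hg',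
      profitDensity]
  have hint' : ∀ g', Integrable (profitDensity ((O j).replace g f w) g') := by
    intro g'
    by_cases hg' : g' = g
    · rwa [hg', hpd]
    · rw [hpd' g' hg']
      exact hO.integrable j g'
  refine hO.2 ⟨j, (O j).replace g f w, ⟨(hOj.isMeasurable.replace hf hw).f,
    (hOj.isMeasurable.replace hf hw).w, ?_, ?_, ?_, ?_, ?_, hr⟩, ?_, ?_⟩
  all_goals try (intro g'; by_cases hg' : g' = g)
  · subst hg'; simpa
  · simpa only [FirmOutcome.replace_f_of_ne hg'] using hOj.f_nonneg g'
  · subst hg'; simpa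
  · simpa only [FirmOutcome.replace_f_of_ne hg'] using hOj.f_le g'
  · subst hg'; simpa
  · simpa only [FirmOutcome.replace_w_of_ne hg'] using hOj.w_nonneg g'
  · subst hg'; simpa
  · simpa only [FirmOutcome.replace_f_of_ne hg', FirmOutcome.replace_w_of_ne hg']
      using hOj.w_eq_zero g'
  · subst hg'; simpa
  · simpa only [FirmOutcome.replace_f_of_ne hg', FirmOutcome.replace_w_of_ne hg']
      using hOj.monotone g'
  · rw [profit_of_integrable M hint', profit_of_integrable M (hO.integrable j),
      EReal.coe_lt_coe_iff]
    cases g with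
    | A =>
      rw [hpd, hpd' .B (by simp)]
      have := mul_lt_mul_of_pos_left hlt M.β_pos
      linarith
    | B =>
      rw [hpd, hpd' .A (by simp)]
      linarith
  · subst hg'; simpa
  · refine Filter.Eventually.of_forall fun v => Or.inr (Or.inl ⟨?_, ?_⟩)
    · rw [FirmOutcome.replace_w_of_ne hg']
    · rw [FirmOutcome.replace_f_of_ne hg']
      exact hO.1.feasible' j g' v

lemma ae_eq_of_ae_le_of_integral_le {h k : Productivity → ℝ} (hh : Integrable h)
    (hk : Integrable k) (hle : ∀ᵐ v, h v ≤ k v) (hint : ∫ v, k v ≤ ∫ v, h v) :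
    ∀ᵐ v, h v = k v := by
  have h0 : ∫ v, (k v - h v) = 0 := by
    refine le_antisymm ?_ (integral_nonneg_of_ae (hle.mono fun v hv => sub_nonneg.mpr hv))
    rw [integral_sub hk hh]
    linarith
  have := (integral_eq_zero_iff_of_nonneg_ae (hle.mono fun v hv => sub_nonneg.mpr hv)
    (hk.sub hh)).mp h0
  exact this.mono fun v hv => (sub_eq_zero.mp hv).symm

lemma integrable_piecewise {h k : Productivity → ℝ} {B D : Set Productivity}
    (hB : MeasurableSet B) (hD : MeasurableSet D) (hk : Integrable k) (hm : Measurable h) {C : ℝ}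
    (hC : ∀ v ∈ B, |h v| ≤ C) : Integrable (B.indicator h + D.indicator k) := by
  refine Integrable.add ?_ (hk.indicator hD)
  refine Integrable.of_bound (hm.indicator hB).aestronglyMeasurable (max C 0)
    (Filter.Eventually.of_forall fun v => ?_)
  by_cases hv : v ∈ B
  · rw [indicator_of_mem hv]
    exact (hC v hv).trans (le_max_left _ _)
  · simp [hv]

/-- In a core outcome no firm pays wages above productivity. -/
lemma IsCoreOutcome.wage_le (hO : IsCoreOutcome M r O) (j : Firm) (g : WorkerGroup) :
    ∀ᵐ v, 0 < (O j).f g v → (O j).w g v ≤ v.val := by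
  have hOj := hO.1.firm j
  -- Tested against dismissing everybody paid above productivity: alternative (2) holds on `K` and
  -- (4) off it, and no remaining wage changes. Since this cannot raise profit, the dismissed
  -- workers cause no loss and so are negligible.
  let K : Set Productivity := {v | (O j).w g v ≤ v.val}
  have hK : MeasurableSet K := measurableSet_le (hOj.measurable_w g) Productivity.measurable_val
  have hf := (hOj.measurable_f g).indicator hK
  have hw := (hOj.measurable_w g).indicator hK
  have hf0 : ∀ v, 0 ≤ K.indicator ((O j).f g) v := fun v =>
    indicator_nonneg (fun v _ => hOj.f_nonneg g v) v
  have hw0 : ∀ v, 0 ≤ K.indicator ((O j).w g) v := fun v =>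
    indicator_nonneg (fun v _ => hOj.w_nonneg g v) v
  have hpd : (fun v => (v.val - K.indicator ((O j).w g) v) * K.indicator ((O j).f g) v)
      = K.indicator (profitDensity (O j) g) := by
    ext v
    by_cases hv : v ∈ K
    · simp only [indicator_of_mem hv, profitDensity]
    · simp [hv]
  have hint : Integrable (K.indicator (profitDensity (O j) g)) := (hO.integrable j g).indicator hK
  have hmain := hO.integral_le j g hf hw hf0
    (fun v => (indicator_le_self' (fun v _ => hOj.f_nonneg g v) v).trans (hOj.f_le g v)) hw0
    (fun v hv => by
      by_cases hvK : v ∈ K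
      · rw [indicator_of_mem hvK] at hv ⊢
        exact hOj.w_eq_zero g v hv
      · simp [hvK])
    (fun v v' hle hv => by
      by_cases hvK : v ∈ K
      · rw [indicator_of_mem hvK] at hv ⊢
        exact (indicator_le_self' (fun v _ => hOj.w_nonneg g v) v').trans
          (hOj.monotone g v v' hle hv)
      · simp [hvK] at hv)
    (hOj.restriction.of_ae_sub hOj.isMeasurable (hOj.isMeasurable.replace hf hw) fun g' => by
      refine Filter.Eventually.of_forall fun v hv => ?_
      by_cases hg' : g' = g
      · subst hg'
        rw [FirmOutcome.replace_f_self] at hv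
        rw [FirmOutcome.replace_w_self]
        by_cases hvK : v ∈ K
        · rw [indicator_of_mem hvK] at hv ⊢
          exact ⟨hv, rfl⟩
        · simp [hvK] at hv
      · rw [FirmOutcome.replace_f_of_ne hg'] at hv
        rw [FirmOutcome.replace_w_of_ne hg']
        exact ⟨hv, rfl⟩)
    (Filter.Eventually.of_forall fun v => by
      by_cases hvK : v ∈ K
      · rw [indicator_of_mem hvK, indicator_of_mem hvK]
        exact Or.inr (Or.inl ⟨le_rfl, hO.1.feasible' j g v⟩)
      · refine Or.inr (Or.inr (Or.inr ?_))
        rw [indicator_of_notMem hvK, zero_add]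
        exact hO.1.feasible' j g v)
    (by rwa [hpd])
  rw [hpd] at hmain
  have hae := ae_eq_of_ae_le_of_integral_le (hO.integrable j g) hint
    (Filter.Eventually.of_forall fun v => by
      by_cases hvK : v ∈ K
      · rw [indicator_of_mem hvK]
      · rw [indicator_of_notMem hvK]
        exact mul_nonpos_of_nonpos_of_nonneg (by
          have : ¬ (O j).w g v ≤ v.val := hvK
          linarith) (hOj.f_nonneg g v)) hmain
  filter_upwards [hae] with v hv hf
  by_contra hcon
  rw [indicator_of_notMem (show v ∉ K from hcon), profitDensity, mul_eq_zero] at hv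
  rcases hv with hv | hv <;> linarith

/-- In a core outcome a firm that could hire at the wages `W` above those of its rival does not
gain from it. -/
lemma IsCoreOutcome.productivity_le_of_lt (hO : IsCoreOutcome M r O) (j : Firm) (g : WorkerGroup)
    {W : Productivity → ℝ} (hW : Monotone W) (hW0 : ∀ v, 0 ≤ W v) {D : Set Productivity}
    (hD : MeasurableSet D) (hDW : ∀ v ∈ D, 0 < (O j).f g v ∧ (O j).w g v = W v)
    (hDae : ∀ᵐ v, 0 < (O j).f g v → v ∈ D)
    (hr : ∀ f w, Measurable f → Measurable w → (∀ v, 0 < f v → w v = W v) →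
      WageRestriction ((O j).replace g f w) r) :
    ∀ᵐ v, 0 < (O j.other).f g v → (O j.other).w g v < W v → v.val ≤ W v := by
  classical
  have hOj := hO.1.firm j
  have hOk := hO.1.firm j.other
  have hWm := Productivity.measurable_of_monotone hW
  obtain ⟨C, hC⟩ := M.upper g
  let B : Set Productivity :=
    {v | 0 < (O j.other).f g v ∧ (O j.other).w g v < W v ∧ W v < v.val}
  have hB : MeasurableSet B := (measurableSet_lt measurable_const (hOk.measurable_f g)).inter
    ((measurableSet_lt (hOk.measurable_w g) hWm).inter
      (measurableSet_lt hWm Productivity.measurable_val))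
  -- On `B` the whole supply is hired, by alternative (1): `W` exceeds the wage of the rival and is
  -- at least the firm's own.
  let f : Productivity → ℝ := fun v => if v ∈ B then M.f g v else if v ∈ D then (O j).f g v else 0
  let w : Productivity → ℝ := fun v => if v ∈ B ∪ D then W v else 0
  have hf : Measurable f := Measurable.ite hB (M.measurable_f g)
    (Measurable.ite hD (hOj.measurable_f g) measurable_const)
  have hw : Measurable w := Measurable.ite (hB.union hD) hWm measurable_const
  have hmemf : ∀ v, v ∈ B ∪ D → 0 < f v := by
    intro v hv
    by_cases hvB : v ∈ B
    · simpa [f, hvB] using M.f_pos g v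
    · have hvD := hv.resolve_left hvB
      simpa [f, hvB, hvD] using (hDW v hvD).1
  have hnmemf : ∀ v, v ∉ B ∪ D → f v = 0 := by
    intro v hv
    rw [mem_union, not_or] at hv
    simp [f, hv.1, hv.2]
  have hfw : ∀ v, 0 < f v → w v = W v := by
    intro v hv
    have : v ∈ B ∪ D := by
      by_contra hcon
      rw [hnmemf v hcon] at hv
      exact lt_irrefl _ hv
    exact if_pos this
  have hw0 : ∀ v, 0 ≤ w v := fun v => by
    simp only [w]
    split_ifs
    exacts [hW0 v, le_rfl]
  have hwW : ∀ v, w v ≤ W v := fun v => by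
    simp only [w]
    split_ifs
    exacts [le_rfl, hW0 v]
  have hpd : (fun v => (v.val - w v) * f v)
      = B.indicator (fun v => (v.val - W v) * M.f g v)
        + (D \ B).indicator (profitDensity (O j) g) := by
    ext v
    by_cases hvB : v ∈ B
    · simp [f, w, hvB]
    · by_cases hvD : v ∈ D
      · simp [f, w, hvB, hvD, profitDensity, (hDW v hvD).2]
      · simp [f, w, hvB, hvD]
  have hint : Integrable fun v => (v.val - w v) * f v := by
    rw [hpd]
    refine integrable_piecewise hB (hD.diff hB) (hO.integrable j g)
      ((Productivity.measurable_val.sub hWm).mul (M.measurable_f g)) (C := C) fun v hv => ?_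
    have h1 : W v < v.val := hv.2.2
    have h2 := M.f_pos g v
    have h3 := hW0 v
    have h4 := v.val_le_one
    have h5 := hC v
    rw [abs_of_nonneg (mul_nonneg (by linarith) h2.le)]
    nlinarith
  have hmain := hO.integral_le j g hf hw
    (fun v => by
      by_cases hv : v ∈ B ∪ D
      · exact (hmemf v hv).le
      · exact (hnmemf v hv).ge)
    (fun v => by
      simp only [f]
      split_ifs
      exacts [le_rfl, hOj.f_le g v, (M.f_pos g v).le])
    hw0
    (fun v hv => by
      by_cases hvm : v ∈ B ∪ D
      · exact absurd hv (hmemf v hvm).ne'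
      · exact if_neg hvm)
    (fun v v' hle hv => by
      rw [hfw v hv]
      exact (hwW v').trans (hW hle))
    (hr f w hf hw hfw)
    (by
      filter_upwards [hDae] with v hv
      by_cases hvB : v ∈ B
      · refine Or.inl ⟨?_, ?_⟩
        · rw [show w v = W v from if_pos (Or.inl hvB)]
          rcases (hOj.f_nonneg g v).eq_or_lt with h0 | h0
          · rw [hOj.w_eq_zero g v h0.symm]
            exact hW0 v
          · exact (hDW v (hv h0)).2.le
        · rw [show w v = W v from if_pos (Or.inl hvB)]
          exact hvB.2.1
      · by_cases hvD : v ∈ D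
        · refine Or.inr (Or.inl ⟨?_, ?_⟩)
          · rw [show w v = W v from if_pos (Or.inr hvD)]
            exact (hDW v hvD).2.le
          · rw [show f v = (O j).f g v by simp [f, hvB, hvD]]
            exact hO.1.feasible' j g v
        · refine Or.inr (Or.inr (Or.inr ?_))
          rw [hnmemf v (by simp [hvB, hvD]), zero_add]
          exact hO.1.feasible' j g v)
    hint
  have hle : ∀ᵐ v, profitDensity (O j) g v ≤ (v.val - w v) * f v := by
    filter_upwards [hDae] with v hv
    rcases (hOj.f_nonneg g v).eq_or_lt with h0 | h0
    · rw [profitDensity, ← h0, mul_zero]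
      by_cases hvB : v ∈ B
      · have h1 : W v < v.val := hvB.2.2
        exact mul_nonneg (by linarith [hwW v]) (hmemf v (Or.inl hvB)).le
      · have hvD : v ∉ D := fun h => (hDW v h).1.ne h0
        rw [hnmemf v (by simp [hvB, hvD]), mul_zero]
    · have hvD := hv h0
      rw [profitDensity, (hDW v hvD).2, show w v = W v from if_pos (Or.inr hvD)]
      by_cases hvB : v ∈ B
      · have h1 : W v < v.val := hvB.2.2
        rw [show f v = M.f g v by simp [f, hvB]]
        exact mul_le_mul_of_nonneg_left (hOj.f_le g v) (by linarith)
      · rw [show f v = (O j).f g v by simp [f, hvB, hvD]]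
  filter_upwards [ae_eq_of_ae_le_of_integral_le (hO.integrable j g) hint hle hmain, hDae]
    with v hv hvD hk hlt
  by_contra! hcon
  have hvB : v ∈ B := ⟨hk, hlt, hcon⟩
  have hfv : f v = M.f g v := by simp [f, hvB]
  have hwv : w v = W v := if_pos (Or.inl hvB)
  -- Equal profit densities on `B` would mean that the firm already hires the full supply there,
  -- leaving none for the rival.
  have hfeas := hO.1.feasible' j g v
  rw [profitDensity, hfv, hwv] at hv
  rcases (hOj.f_nonneg g v).eq_or_lt with h0 | h0
  · rw [← h0, mul_zero] at hv
    exact (mul_pos (sub_pos.mpr hcon) (M.f_pos g v)).ne hv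
  · rw [(hDW v (hvD h0)).2] at hv
    have := mul_left_cancel₀ (sub_pos.mpr hcon).ne' hv
    linarith

end Core


/-! ## Density points -/

lemma Productivity.volume_image_val (B : Set Productivity) :
    volume (Productivity.val '' B) = volume B := by
  have h : (volume : Measure Productivity) B
      = (volume : Measure (Set.Icc (0 : ℝ) 1)) (show Set (Set.Icc (0 : ℝ) 1) from B) :=
    Measure.completion_apply _ _
  rw [h, ← volume_image_subtype_coe measurableSet_Icc]
  rfl

/-- The productivities between `b` and `b + L`. -/
def Productivity.interval (b L : ℝ) : Set Productivity :=
  {v | b ≤ v.val ∧ v.val ≤ b + L}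

lemma Productivity.measurableSet_interval (b L : ℝ) :
    MeasurableSet (Productivity.interval b L) :=
  (measurableSet_le measurable_const Productivity.measurable_val).inter
    (measurableSet_le Productivity.measurable_val measurable_const)

lemma Productivity.volume_interval_le (b L : ℝ) :
    volume (Productivity.interval b L) ≤ ENNReal.ofReal L := by
  have h : Productivity.interval b L = Productivity.val ⁻¹' Set.Icc b (b + L) := rfl
  rw [h, Productivity.volume_preimage_val]
  refine (measure_mono inter_subset_left).trans ?_
  rw [Real.volume_Icc, add_sub_cancel_left]

lemma Productivity.exists_dense_interval {B : Set Productivity} (hB : 0 < volume B) {η : ℝ}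
    (hη : 0 < η) :
    ∃ b ∈ B, ∃ L : ℝ, 0 < L ∧
      ENNReal.ofReal ((1 - η) * L) ≤ volume (B ∩ Productivity.interval b.val L) := by
  set A := Productivity.val '' B with hA
  have hdens := IsUnifLocDoublingMeasure.ae_tendsto_measure_inter_div (volume : Measure ℝ) A 1
  have hex : ∃ x ∈ A, ∀ {ι : Type} {l : Filter ι} (w : ι → ℝ) (δ : ι → ℝ)
      (_ : Filter.Tendsto δ l (nhdsWithin 0 (Ioi 0)))
      (_ : ∀ᶠ j in l, x ∈ Metric.closedBall (w j) (1 * δ j)),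
      Filter.Tendsto (fun j => volume (A ∩ Metric.closedBall (w j) (δ j)) /
        volume (Metric.closedBall (w j) (δ j))) l (nhds 1) := by
    by_contra hcon
    have hz := (Measure.le_restrict_apply A _).trans (ae_iff.mp hdens).le
    rw [nonpos_iff_eq_zero] at hz
    refine hB.ne' ?_
    rw [← Productivity.volume_image_val]
    refine measure_mono_null ?_ hz
    intro x hx
    refine ⟨?_, hx⟩
    exact fun h => hcon ⟨x, hx, fun w δ h1 h2 => h w δ h1 h2⟩
  obtain ⟨x, ⟨b, hb, rfl⟩, hx⟩ := hex
  have hδ : Filter.Tendsto (fun n : ℕ => 1 / ((n : ℝ) + 1)) Filter.atTop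
      (nhdsWithin 0 (Ioi 0)) :=
    tendsto_nhdsWithin_iff.mpr ⟨tendsto_one_div_add_atTop_nhds_zero_nat,
      Filter.Eventually.of_forall fun n => by
        show (0 : ℝ) < 1 / ((n : ℝ) + 1)
        positivity⟩
  -- Balls that have the density point on their boundary: centre `b + δ` and radius `δ` give an
  -- interval starting at `b`.
  have hlim := hx (fun n : ℕ => b.val + 1 / ((n : ℝ) + 1)) _ hδ
    (Filter.Eventually.of_forall fun n => by
      have : (0 : ℝ) < 1 / ((n : ℝ) + 1) := by positivity
      rw [Metric.mem_closedBall, Real.dist_eq, one_mul, sub_add_cancel_left, abs_neg,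
        abs_of_pos this])
  have hlt : ENNReal.ofReal (1 - η) < 1 := by
    rw [← ENNReal.ofReal_one]
    exact (ENNReal.ofReal_lt_ofReal_iff one_pos).mpr (by linarith)
  obtain ⟨n, hn⟩ := (hlim.eventually (lt_mem_nhds hlt)).exists
  set δ : ℝ := 1 / ((n : ℝ) + 1) with hδdef
  have hδ0 : 0 < δ := by positivity
  refine ⟨b, hb, 2 * δ, by linarith, ?_⟩
  have hball : Metric.closedBall (b.val + δ) δ = Set.Icc b.val (b.val + 2 * δ) := by
    rw [Real.closedBall_eq_Icc]
    congr 1 <;> ring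
  have himage : Productivity.val '' (B ∩ Productivity.interval b.val (2 * δ))
      = A ∩ Set.Icc b.val (b.val + 2 * δ) := 
    image_inter_preimage Productivity.val B (Set.Icc b.val (b.val + 2 * δ))
  rw [← Productivity.volume_image_val, himage]
  rw [hball, Real.volume_Icc, add_sub_cancel_left] at hn
  have h2 := ENNReal.mul_le_of_le_div hn.le
  by_cases h1 : 0 ≤ 1 - η
  · rwa [ENNReal.ofReal_mul h1]
  · rw [ENNReal.ofReal_of_nonpos (mul_nonpos_of_nonpos_of_nonneg (not_le.mp h1).le (by linarith))]
    exact zero_le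

/-- Every set of positive measure has a large share of the upper half of some short interval that
starts in the set and misses little of the interval. -/
lemma Productivity.exists_interval {B : Set Productivity} (hBm : MeasurableSet B)
    (hB : 0 < volume B) {η : ℝ} (hη : 0 < η) (hη' : η ≤ 1 / 4) :
    ∃ b ∈ B, ∃ L : ℝ, 0 < L ∧
      L / 4 ≤ volume.real (B ∩ Productivity.interval (b.val + L / 2) (L / 2)) ∧
      volume.real (Productivity.interval b.val L \ B) ≤ η * L := by
  obtain ⟨b, hb, L, hL, hle⟩ := Productivity.exists_dense_interval hB hη
  have hreal : (1 - η) * L ≤ volume.real (B ∩ Productivity.interval b.val L) :=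
    (ENNReal.ofReal_le_iff_le_toReal (measure_ne_top _ _)).mp hle
  have hint : ∀ (c l : ℝ), 0 ≤ l → volume.real (Productivity.interval c l) ≤ l := fun c l hl =>
    ENNReal.toReal_le_of_le_ofReal hl (Productivity.volume_interval_le c l)
  refine ⟨b, hb, L, hL, ?_, ?_⟩
  · have hsub : B ∩ Productivity.interval b.val L ⊆
        (B ∩ Productivity.interval (b.val + L / 2) (L / 2)) ∪
          Productivity.interval b.val (L / 2) := by
      rintro v ⟨hv, hv1, hv2⟩
      rcases le_total (b.val + L / 2) v.val with h | h
      · exact Or.inl ⟨hv, h, by linarith⟩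
      · exact Or.inr ⟨hv1, h⟩
    have h1 := (measureReal_mono hsub (μ := volume)).trans (measureReal_union_le _ _)
    have h2 := hint b.val (L / 2) (by linarith)
    nlinarith
  · have h1 := measureReal_inter_add_sdiff (μ := volume) (s := Productivity.interval b.val L) hBm
    have h2 := hint b.val L hL.le
    rw [inter_comm] at h1
    linarith

/-! ### Monotonicity of core wages across the two firms -/

section Core

variable {M : Market} {r : Regime} {O : Firm → FirmOutcome}

/-- In a core outcome a firm that is free to choose its wages does not pay wages that rise to the
productivities of workers whom its rival pays less. -/
lemma IsCoreOutcome.productivity_ne_of_lt (hO : IsCoreOutcome M r O) (j : Firm) (g : WorkerGroup)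
    {W : Productivity → ℝ} (hW : Monotone W) {D : Set Productivity}
    (hD : MeasurableSet D) (hDW : ∀ v ∈ D, 0 < (O j).f g v ∧ (O j).w g v = W v)
    (hDae : ∀ᵐ v, 0 < (O j).f g v → v ∈ D)
    (hr : ∀ f w, Measurable f → Measurable w → WageRestriction ((O j).replace g f w) r) :
    ∀ᵐ v, 0 < (O j.other).f g v → (O j.other).w g v < W v → W v ≠ v.val := by
  classical
  have hOj := hO.1.firm j
  have hOk := hO.1.firm j.other
  have hWm := Productivity.measurable_of_monotone hW
  by_contra hcon
  obtain ⟨C, hC⟩ := M.upper g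
  -- Countable decomposition that makes two bounds uniform: the rival hires at least `1/(n+1)`, and
  -- `q` separates all its wages from all productivities in the set. In particular the wage `b`
  -- exceeds the rival's wages on all of `B`.
  let B' : ℚ × ℕ → Set Productivity := fun p =>
    {v | 1 / ((p.2 : ℝ) + 1) ≤ (O j.other).f g v ∧ (O j.other).w g v < p.1 ∧ (p.1 : ℝ) < v.val ∧
      W v = v.val}
  have hcover : {v | ¬ (0 < (O j.other).f g v → (O j.other).w g v < W v → W v ≠ v.val)} ⊆
      ⋃ p, B' p := by
    intro v hv
    simp only [mem_ofPred_eq, Classical.not_imp, not_not] at hv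
    obtain ⟨hf, hlt, heq⟩ := hv
    obtain ⟨n, hn⟩ := exists_nat_one_div_lt hf
    obtain ⟨q, hq, hq'⟩ := exists_rat_btwn (heq ▸ hlt)
    exact mem_iUnion.mpr ⟨(q, n), hn.le, hq, hq', heq⟩
  obtain ⟨⟨q, n⟩, hp⟩ := exists_measure_pos_of_not_measure_iUnion_null
    fun h => hcon (ae_iff.mpr (measure_mono_null hcover h))
  set B := B' (q, n) with hBdef
  have hB : MeasurableSet B := (measurableSet_le measurable_const (hOk.measurable_f g)).inter
    ((measurableSet_lt (hOk.measurable_w g) measurable_const).inter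
      ((measurableSet_lt measurable_const Productivity.measurable_val).inter
        (measurableSet_eq_fun hWm Productivity.measurable_val)))
  set c : ℝ := 1 / ((n : ℝ) + 1) with hc
  have hc0 : 0 < c := by positivity
  obtain ⟨v₀⟩ : Nonempty Productivity := (nonempty_of_measure_ne_zero hp.ne').to_type
  have hC0 : 0 < C := (M.f_pos g v₀).trans_le (hC v₀)
  -- With this `η`, the gain on the upper half of the interval is at least `c * L ^ 2 / 8`, while
  -- the loss off `B` is at most `η * L * (C * L) ≤ c * L ^ 2 / 16`.
  obtain ⟨b, hb, L, hL, hL1, hL2⟩ := Productivity.exists_interval hB hp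
    (η := min (1 / 4) (c / (16 * C))) (by positivity) (min_le_left _ _)
  set I := Productivity.interval b.val L with hI
  have hIm : MeasurableSet I := Productivity.measurableSet_interval _ _
  have hWb : W b = b.val := hb.2.2.2
  have hWge : ∀ v ∈ I, b.val ≤ W v := fun v hv =>
    hWb.symm.le.trans (hW (Productivity.val_le_val.mp hv.1))
  -- On `I ∩ B` the firm swaps its own workers, on whom it earns nothing because `W v = v`, for as
  -- many as the rival hires, at the flat wage `b`; this is alternative (3). The rest of `I` is
  -- dropped, since wages there may exceed `b` and break monotonicity.
  let f : Productivity → ℝ := fun v =>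
    if v ∈ I then (if v ∈ B then (O j.other).f g v else 0) else if v ∈ D then (O j).f g v else 0
  let w : Productivity → ℝ := fun v =>
    if v ∈ I then (if v ∈ B then b.val else 0) else if v ∈ D then (O j).w g v else 0
  have hf : Measurable f := Measurable.ite hIm
    (Measurable.ite hB (hOk.measurable_f g) measurable_const)
    (Measurable.ite hD (hOj.measurable_f g) measurable_const)
  have hw : Measurable w := Measurable.ite hIm
    (Measurable.ite hB measurable_const measurable_const)
    (Measurable.ite hD (hOj.measurable_w g) measurable_const)
  have hBf : ∀ v ∈ B, 0 < (O j.other).f g v := fun v hv => hc0.trans_le hv.1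
  have hw0 : ∀ v, 0 ≤ w v := fun v => by
    simp only [w]
    split_ifs
    exacts [b.val_nonneg, le_rfl, hOj.w_nonneg g v, le_rfl]
  have hpd : (fun v => (v.val - w v) * f v)
      = (I ∩ B).indicator (fun v => (v.val - b.val) * (O j.other).f g v)
        + (D \ I).indicator (profitDensity (O j) g) := by
    ext v
    by_cases hvI : v ∈ I
    · by_cases hvB : v ∈ B <;> simp [f, w, hvI, hvB]
    · by_cases hvD : v ∈ D <;> simp [f, w, hvI, hvD, profitDensity]
  have hint : Integrable fun v => (v.val - w v) * f v := by
    rw [hpd]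
    refine integrable_piecewise (hIm.inter hB) (hD.diff hIm) (hO.integrable j g)
      ((Productivity.measurable_val.sub_const _).mul (hOk.measurable_f g)) (C := C) fun v hv => ?_
    have h1 : b.val ≤ v.val := hv.1.1
    have h2 := hOk.f_nonneg g v
    have h3 := b.val_nonneg
    have h4 := v.val_le_one
    have h5 := (hOk.f_le g v).trans (hC v)
    rw [abs_of_nonneg (mul_nonneg (by linarith) h2)]
    nlinarith
  have hmain := hO.integral_le j g hf hw
    (fun v => by
      simp only [f]
      split_ifs
      exacts [hOk.f_nonneg g v, le_rfl, hOj.f_nonneg g v, le_rfl])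
    (fun v => by
      simp only [f]
      split_ifs
      exacts [hOk.f_le g v, (M.f_pos g v).le, hOj.f_le g v, (M.f_pos g v).le])
    hw0
    (fun v hv => by
      simp only [f] at hv
      simp only [w]
      split_ifs at hv ⊢ with h1 h2 h3
      · exact absurd hv (hBf v h2).ne'
      · rfl
      · exact absurd hv (hDW v h3).1.ne'
      · rfl)
    (fun v v' hle hv => by
      have hle' := Productivity.val_le_val.mpr hle
      by_cases hvI : v ∈ I
      · have hvB : v ∈ B := by
          by_contra h
          simp [f, hvI, h] at hv
        have hwv : w v = b.val := by simp [w, hvI, hvB]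
        rw [hwv]
        simp only [w]
        split_ifs with h1 h2 h3
        · exact le_rfl
        · exact b.val_nonneg
        · rw [(hDW v' h3).2, ← hWb]
          have h4 : ¬ b.val ≤ v'.val := fun h => h1 ⟨h, hle'.trans hvI.2⟩
          exact hW (Productivity.val_le_val.mp (not_le.mp h4).le)
        · exact b.val_nonneg
      · have hvD : v ∈ D := by
          by_contra h
          simp [f, hvI, h] at hv
        have hwv : w v = W v := by simp [w, hvI, hvD, (hDW v hvD).2]
        have hW0 : 0 ≤ W v := hwv ▸ hw0 v
        rw [hwv]
        simp only [w]
        split_ifs with h1 h2 h3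
        · rw [← hWb]
          exact hW (Productivity.val_le_val.mp (h1.1.trans hle'))
        · exact hW0
        · rw [(hDW v' h3).2]
          exact hW hle
        · exact hW0)
    (hr f w hf hw)
    (Filter.Eventually.of_forall fun v => by
      have hfeas := hO.1.feasible' j g v
      by_cases hvI : v ∈ I
      · by_cases hvB : v ∈ B
        · refine Or.inr (Or.inr (Or.inl ⟨?_, ?_⟩))
          · rw [show w v = b.val by simp [w, hvI, hvB]]
            exact (hvB.2.1).trans hb.2.2.1
          · rw [show f v = (O j.other).f g v by simp [f, hvI, hvB]]
            linarith
        · refine Or.inr (Or.inr (Or.inr ?_))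
          rw [show f v = 0 by simp [f, hvI, hvB]]
          linarith
      · by_cases hvD : v ∈ D
        · refine Or.inr (Or.inl ⟨?_, ?_⟩)
          · rw [show w v = (O j).w g v by simp [w, hvI, hvD]]
          · rwa [show f v = (O j).f g v by simp [f, hvI, hvD]]
        · refine Or.inr (Or.inr (Or.inr ?_))
          rw [show f v = 0 by simp [f, hvI, hvD]]
          linarith)
    hint
  set U := B ∩ Productivity.interval (b.val + L / 2) (L / 2) with hU
  have hUm : MeasurableSet U := hB.inter (Productivity.measurableSet_interval _ _)
  have hlow : ∀ᵐ v, U.indicator (fun _ => c * (L / 2)) v - (I \ B).indicator (fun _ => C * L) v ≤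
      (v.val - w v) * f v - profitDensity (O j) g v := by
    filter_upwards [hDae] with v hvD
    have hdich : profitDensity (O j) g v = 0 ∨ v ∈ D := by
      rcases (hOj.f_nonneg g v).eq_or_lt with h0 | h0
      · exact Or.inl (by rw [profitDensity, ← h0, mul_zero])
      · exact Or.inr (hvD h0)
    by_cases hvI : v ∈ I
    · by_cases hvB : v ∈ B
      · have hz : profitDensity (O j) g v = 0 := by
          rcases hdich with h | h
          · exact h
          · rw [profitDensity, (hDW v h).2, hvB.2.2.2, sub_self, zero_mul]
        have hvb : b.val ≤ v.val := hvI.1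
        rw [hz, sub_zero, indicator_of_notMem (fun h => h.2 hvB : v ∉ I \ B), sub_zero,
          show f v = (O j.other).f g v by simp [f, hvI, hvB],
          show w v = b.val by simp [w, hvI, hvB]]
        have hcf : c ≤ (O j.other).f g v := hvB.1
        by_cases hvU : v ∈ U
        · rw [indicator_of_mem hvU]
          have h1 : b.val + L / 2 ≤ v.val := hvU.2.1
          calc c * (L / 2) = (L / 2) * c := mul_comm _ _
            _ ≤ (v.val - b.val) * (O j.other).f g v :=
              mul_le_mul (by linarith) hcf hc0.le (by linarith)
        · rw [indicator_of_notMem hvU]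
          exact mul_nonneg (by linarith) (hc0.le.trans hcf)
      · rw [indicator_of_notMem (fun h => hvB h.1 : v ∉ U), indicator_of_mem (show v ∈ I \ B from ⟨hvI, hvB⟩),
          show f v = 0 by simp [f, hvI, hvB], mul_zero, zero_sub, zero_sub, neg_le_neg_iff]
        rcases hdich with h | h
        · rw [h]
          positivity
        · rw [profitDensity, (hDW v h).2]
          have h1 := hWge v hvI
          have h2 : v.val ≤ b.val + L := hvI.2
          have h3 := (hDW v h).1
          have h4 := (hOj.f_le g v).trans (hC v)
          calc (v.val - W v) * (O j).f g v ≤ L * (O j).f g v :=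
                mul_le_mul_of_nonneg_right (by linarith) h3.le
            _ ≤ C * L := by nlinarith
    · have hvU : v ∉ U := fun h => hvI ⟨by linarith [h.2.1], by linarith [h.2.2]⟩
      rw [indicator_of_notMem hvU, indicator_of_notMem (fun h => hvI h.1 : v ∉ I \ B), sub_zero]
      by_cases hvD' : v ∈ D
      · simp [f, w, hvI, hvD', profitDensity]
      · rw [hdich.resolve_right hvD', show f v = 0 by simp [f, hvI, hvD']]
        simp
  have hi1 : Integrable (U.indicator fun _ : Productivity => c * (L / 2)) :=
    (integrable_const _).indicator hUm
  have hi2 : Integrable ((I \ B).indicator fun _ : Productivity => C * L) :=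
    (integrable_const _).indicator (hIm.diff hB)
  have hfin := integral_mono_ae (hi1.sub hi2) (hint.sub (hO.integrable j g)) hlow
  rw [integral_sub' hi1 hi2, integral_sub' hint (hO.integrable j g), integral_indicator_const _ hUm,
    integral_indicator_const _ (hIm.diff hB), smul_eq_mul, smul_eq_mul] at hfin
  have h1 : L / 4 * (c * (L / 2)) ≤ volume.real U * (c * (L / 2)) :=
    mul_le_mul_of_nonneg_right hL1 (by positivity)
  have h2 : volume.real (I \ B) * (C * L) ≤ (c / (16 * C) * L) * (C * L) := by
    refine mul_le_mul_of_nonneg_right (hL2.trans ?_) (by positivity)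
    exact mul_le_mul_of_nonneg_right (min_le_right _ _) hL.le
  have h3 : (c / (16 * C) * L) * (C * L) = c * L ^ 2 / 16 := by
    field_simp
  have h4 : 0 < c * L ^ 2 := by positivity
  have h5 : L / 4 * (c * (L / 2)) = c * L ^ 2 / 8 := by ring
  linarith

/-- In a core outcome, in each group, a firm does not pay a worker less than its rival pays a worker
who is not more productive. -/
lemma IsCoreOutcome.exists_wage_le_other (hO : IsCoreOutcome M r O) (j : Firm) (g : WorkerGroup) :
    ∃ Y : Set Productivity, (∀ᵐ v, v ∈ Y) ∧ ∀ v ∈ Y, ∀ v' ∈ Y, v' ≤ v →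
      0 < (O j.other).f g v → 0 < (O j).f g v' → (O j).w g v' ≤ (O j.other).w g v := by
  have hOj := hO.1.firm j
  have hOk := hO.1.firm j.other
  have hmf : MeasurableSet {v | 0 < (O j).f g v} := measurableSet_hires hOj.isMeasurable g
  have hwle := hO.wage_le j g
  rcases hOj.restriction_cases g with hnone | hfree | ⟨c, hc, hcr⟩
  · exact ⟨_, hnone, fun v _ v' hv' _ _ hf => absurd hf hv'⟩
  · let D : Set Productivity := {v | 0 < (O j).f g v ∧ (O j).w g v ≤ v.val}
    have hD : MeasurableSet D :=
      hmf.inter (measurableSet_le (hOj.measurable_w g) Productivity.measurable_val)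
    -- The running supremum of the firm's wages extends them to a monotone schedule on all
    -- productivities. It stays below productivity because wages on `D` do, so the two perturbation
    -- lemmas together exclude a rival wage below it.
    let T : Productivity → Set ℝ := fun v => insert 0 ((O j).w g '' (D ∩ Iic v))
    have hT : ∀ v, ∀ y ∈ T v, y ≤ v.val := by
      rintro v y (rfl | ⟨u, ⟨hu, huv⟩, rfl⟩)
      · exact v.val_nonneg
      · exact hu.2.trans (Productivity.val_le_val.mpr huv)
    have hTb : ∀ v, BddAbove (T v) := fun v => ⟨v.val, hT v⟩
    let W : Productivity → ℝ := fun v => sSup (T v)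
    have hW : Monotone W := fun v v' hle => csSup_le_csSup (hTb v') (insert_nonempty _ _)
      (insert_subset_insert (image_mono (inter_subset_inter_right _ (Iic_subset_Iic.mpr hle))))
    have hW0 : ∀ v, 0 ≤ W v := fun v => le_csSup (hTb v) (mem_insert _ _)
    have hWv : ∀ v, W v ≤ v.val := fun v => csSup_le (insert_nonempty _ _) (hT v)
    have hwW : ∀ v' ∈ D, ∀ v, v' ≤ v → (O j).w g v' ≤ W v := fun v' hv' v hle =>
      le_csSup (hTb v) (mem_insert_of_mem _ ⟨v', ⟨hv', hle⟩, rfl⟩)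
    have hDW : ∀ v ∈ D, 0 < (O j).f g v ∧ (O j).w g v = W v := by
      refine fun v hv => ⟨hv.1, le_antisymm (hwW v hv v le_rfl) (csSup_le (insert_nonempty _ _) ?_)⟩
      rintro y (rfl | ⟨u, ⟨hu, huv⟩, rfl⟩)
      · exact hOj.w_nonneg g v
      · exact hOj.monotone g v u huv hv.1
    have hDae : ∀ᵐ v, 0 < (O j).f g v → v ∈ D := hwle.mono fun v hv hf => ⟨hf, hv hf⟩
    have hA := hO.productivity_le_of_lt j g hW hW0 hD hDW hDae fun f w hf hw _ => hfree f w hf hw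
    have hB := hO.productivity_ne_of_lt j g hW hD hDW hDae hfree
    refine ⟨{v | (0 < (O j.other).f g v → W v ≤ (O j.other).w g v) ∧
      (0 < (O j).f g v → v ∈ D)}, ?_, fun v hv v' hv' hle hf hf' => ?_⟩
    · filter_upwards [hA, hB, hDae] with v h1 h2 h3
      refine ⟨fun hf => ?_, h3⟩
      by_contra! hlt
      exact h2 hf hlt (le_antisymm (hWv v) (h1 hf hlt))
    · exact (hwW v' (hv'.2 hf') v hle).trans (hv.1 hf)
  · by_cases hc0 : c < 0
    · refine ⟨_, hc g, fun v _ v' hv' _ _ hf' => absurd (hv' hf') ?_⟩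
      have := hOj.w_nonneg g v'
      intro h
      linarith
    have hD : MeasurableSet {v | 0 < (O j).f g v ∧ (O j).w g v = c} :=
      hmf.inter (measurableSet_eq_fun (hOj.measurable_w g) measurable_const)
    have hA := hO.productivity_le_of_lt j g (W := fun _ => c) monotone_const
      (fun _ => not_lt.mp hc0) hD (fun v hv => hv) ((hc g).mono fun v hv hf => ⟨hf, hv hf⟩)
      fun f w hf hw hfw => hcr _ (hOj.isMeasurable.replace hf hw) fun g' => by
        by_cases hg' : g' = g
        · subst hg'
          rw [FirmOutcome.replace_f_self, FirmOutcome.replace_w_self]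
          exact Filter.Eventually.of_forall hfw
        · rw [FirmOutcome.replace_f_of_ne hg', FirmOutcome.replace_w_of_ne hg']
          exact hc g'
    -- A violation at `v' ≤ v` gives `v ≤ c`, while `c ≤ v'` because the firm pays `c` at `v'`;
    -- hence `v = c`, a single productivity that is removed.
    refine ⟨{v | (0 < (O j.other).f g v → (O j.other).w g v < c → v.val ≤ c) ∧
      (0 < (O j).f g v → (O j).w g v = c) ∧ (0 < (O j).f g v → (O j).w g v ≤ v.val) ∧
      v.val ≠ c}, ?_, fun v hv v' hv' hle hf hf' => ?_⟩
    · filter_upwards [hA, hc g, hwle, Productivity.ae_val_ne c] with v h1 h2 h3 h4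
      exact ⟨h1, h2, h3, h4⟩
    · by_contra! hlt
      have h1 := hv'.2.1 hf'
      have h2 := hv'.2.2.1 hf'
      rw [h1] at hlt h2
      exact hv.2.2.2 (le_antisymm (hv.1 hf hlt) (h2.trans (Productivity.val_le_val.mpr hle)))

/-- In a core outcome, up to a null set, wages in a group are non-decreasing in productivity across
the two firms. -/
lemma IsCoreOutcome.exists_monotone_wages (hO : IsCoreOutcome M r O) (g : WorkerGroup) :
    ∃ Y : Set Productivity, MeasurableSet Y ∧ (∀ᵐ v, v ∈ Y) ∧ ∀ v ∈ Y, ∀ v' ∈ Y, v' ≤ v →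
      ∀ i j, 0 < (O i).f g v → 0 < (O j).f g v' → (O j).w g v' ≤ (O i).w g v := by
  choose Y hY hmono using fun j => hO.exists_wage_le_other j g
  obtain ⟨N, hN, hNm, hN0⟩ := exists_measurable_superset_of_null
    (ae_iff.mp ((hY .one).and (hY .two)))
  have hsub : ∀ v ∈ Nᶜ, ∀ j, v ∈ Y j := by
    intro v hv j
    have h : v ∈ Y .one ∧ v ∈ Y .two := by
      by_contra hcon
      exact hv (hN hcon)
    cases j
    exacts [h.1, h.2]
  refine ⟨Nᶜ, hNm.compl, compl_mem_ae_iff.mpr hN0, fun v hv v' hv' hle i j hf hf' => ?_⟩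
  rcases j.eq_or_eq_other i with rfl | rfl
  · exact (hO.1.firm i).monotone g v v' hle hf
  · exact hmono j v (hsub v hv j) v' (hsub v' hv' j) hle hf hf'

end Core


/-! ## Core outcomes are equilibrium outcomes -/

open Classical in
/-- The optimal strategies of workers who break ties in favour of the firm `pref g x`. -/
def WorkerStrategies.ofPreference (pref : WorkerGroup → Worker → Firm) : WorkerStrategies where
  choice g x o :=
    if (o (pref g x)).isSome ∧ 0 ≤ workerPayoff o (some (pref g x)) ∧
        workerPayoff o (some (pref g x).other) ≤ workerPayoff o (some (pref g x)) then
      some (pref g x)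
    else if (o (pref g x).other).isSome ∧ 0 ≤ workerPayoff o (some (pref g x).other) ∧
        workerPayoff o (some (pref g x)) ≤ workerPayoff o (some (pref g x).other) then
      some (pref g x).other
    else none
  available g x o := by
    split_ifs with h1 h2
    exacts [h1.1, h2.1, trivial]

lemma isSome_of_workerPayoff_pos {o : Offers} {i : Firm} (h : 0 < workerPayoff o (some i)) :
    (o i).isSome := by
  cases ho : o i with
  | none => simp [workerPayoff, ho] at h
  | some _ => rfl

section Game

variable [MeasurableSpace Index] {M : Market} {μw : WorkerGroup → Measure Index}
  {r : Regime} {a : Firm → Announcement} {O : Firm → FirmOutcome}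
  {pref : WorkerGroup → Worker → Firm} {i j : Firm} {g : WorkerGroup}

lemma optimalChoices_ofPreference : OptimalChoices (WorkerStrategies.ofPreference pref) := by
  intro b g x d hd
  have hd' : d = none ∨ d = some (pref g x) ∨ d = some (pref g x).other := by
    cases d with
    | none => exact Or.inl rfl
    | some k =>
      rcases (pref g x).eq_or_eq_other k with h | h
      · exact Or.inr (Or.inl (congrArg some h))
      · exact Or.inr (Or.inr (congrArg some h))
  have hnone : ∀ o, workerPayoff o none = 0 := fun _ => rfl
  simp only [WorkerStrategies.ofPreference]
  split_ifs with h1 h2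
  · rcases hd' with rfl | rfl | rfl
    exacts [h1.2.1, le_rfl, h1.2.2]
  · rcases hd' with rfl | rfl | rfl
    exacts [h2.2.1, h2.2.2, le_rfl]
  · rw [hnone]
    by_contra! hpos
    have hk : 0 < workerPayoff (offers b g x) (some (pref g x)) ∨
        0 < workerPayoff (offers b g x) (some (pref g x).other) := by
      rcases hd' with rfl | rfl | rfl
      exacts [absurd hpos (lt_irrefl _), Or.inl hpos, Or.inr hpos]
    rcases le_total (workerPayoff (offers b g x) (some (pref g x).other))
      (workerPayoff (offers b g x) (some (pref g x))) with hle | hle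
    · have h : 0 < workerPayoff (offers b g x) (some (pref g x)) :=
        hk.elim id fun h => h.trans_le hle
      exact h1 ⟨isSome_of_workerPayoff_pos h, h.le, hle⟩
    · have h : 0 < workerPayoff (offers b g x) (some (pref g x).other) :=
        hk.elim (fun h => h.trans_le hle) id
      exact h2 ⟨isSome_of_workerPayoff_pos h, h.le, hle⟩

lemma mem_hired_ofPreference {x : Worker} (hx : x ∈ (a (pref g x)).S g)
    (h0 : 0 ≤ (a (pref g x)).w g x)
    (hle : x ∈ (a (pref g x).other).S g → (a (pref g x).other).w g x ≤ (a (pref g x)).w g x) :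
    x ∈ hired a (WorkerStrategies.ofPreference pref) (pref g x) g := by
  refine if_pos ⟨by simp [offers_of_mem hx], by rwa [workerPayoff_of_mem hx], ?_⟩
  rw [workerPayoff_of_mem hx]
  by_cases hk : x ∈ (a (pref g x).other).S g
  · rw [workerPayoff_of_mem hk]
    exact hle hk
  · simpa [workerPayoff, offers_of_notMem hk] using h0

/-- Ties go to the preferred firm, so the other one hires only by overbidding strictly. This
supplies the strict inequality of alternative (1). -/
lemma lt_of_mem_hired_ofPreference {x : Worker}
    (hx : x ∈ hired a (WorkerStrategies.ofPreference pref) (pref g x).other g)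
    (hS : x ∈ (a (pref g x)).S g) (h0 : 0 ≤ (a (pref g x)).w g x) :
    (a (pref g x)).w g x < (a (pref g x).other).w g x := by
  by_contra! hle
  exact disjoint_left.mp (disjoint_hired (pref g x).other_ne.symm)
    (mem_hired_ofPreference hS h0 fun _ => hle) hx

variable [∀ g, IsProbabilityMeasure (μw g)]

/-- Disjoint measurable sets of workers with the sizes that an outcome prescribes. -/
lemma IsOutcome.exists_assignment (hO : IsOutcome M r O) (hna : ∀ g, NonAtomic (μw g))
    (g : WorkerGroup) :
    ∃ H : Firm → Set Worker, (∀ i, MeasurableSet (H i)) ∧ Disjoint (H .one) (H .two) ∧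
      (∀ i, ∀ x ∈ H i, 0 < (O i).f g x.1) ∧
      ∀ i v, M.f g v * (μw g).real {t | (v, t) ∈ H i} = (O i).f g v := by
  have hρ : ∀ i, Measurable fun v => ENNReal.ofReal ((O i).f g v / M.f g v) := fun i =>
    (((hO.firm i).measurable_f g).div (M.measurable_f g)).ennreal_ofReal
  have hnn : ∀ i v, 0 ≤ (O i).f g v / M.f g v := fun i v =>
    div_nonneg ((hO.firm i).f_nonneg g v) (M.f_pos g v).le
  obtain ⟨S, -, hSm, hS⟩ := exists_measurable_sections (hna g) MeasurableSet.univ (hρ .one)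
    fun v => by
      simpa using div_le_one_of_le₀ ((hO.firm .one).f_le g v) (M.f_pos g v).le
  -- The second set is cut out of the complement of the first, which is large enough by feasibility.
  obtain ⟨T, hTS, hTm, hT⟩ := exists_measurable_sections (hna g) hSm.compl (hρ .two)
    fun v => by
      have h : {t | (v, t) ∈ Sᶜ} = {t | (v, t) ∈ S}ᶜ := rfl
      have hSv : MeasurableSet {t | (v, t) ∈ S} := measurable_prodMk_left hSm
      rw [h, prob_compl_eq_one_sub hSv, hS, ← ENNReal.ofReal_one,
        ← ENNReal.ofReal_sub _ (hnn .one v)]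
      refine ENNReal.ofReal_le_ofReal ?_
      rw [le_sub_iff_add_le, ← add_div, add_comm]
      exact div_le_one_of_le₀ (hO.feasible g v) (M.f_pos g v).le
  let R : Firm → Set Worker := fun i => match i with
    | .one => S
    | .two => T
  have hRm : ∀ i, MeasurableSet (R i) := fun i => by
    cases i
    exacts [hSm, hTm]
  have hR : ∀ i v, μw g {t | (v, t) ∈ R i} = ENNReal.ofReal ((O i).f g v / M.f g v) := by
    intro i v
    cases i
    exacts [hS v, hT v]
  refine ⟨fun i => R i ∩ {x | 0 < (O i).f g x.1}, fun i => (hRm i).inter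
    (measurableSet_lt measurable_const (((hO.firm i).measurable_f g).comp measurable_fst)),
    ?_, fun i x hx => hx.2, fun i v => ?_⟩
  · exact disjoint_left.mpr fun x hx hx' => hTS hx'.1 hx.1
  · by_cases hf : 0 < (O i).f g v
    · have h : {t | (v, t) ∈ R i ∩ {x | 0 < (O i).f g x.1}} = {t | (v, t) ∈ R i} := by
        ext t
        simp [hf]
      rw [h, Measure.real, hR, ENNReal.toReal_ofReal (hnn i v),
        mul_div_cancel₀ _ (M.f_pos g v).ne']
    · have h : {t | (v, t) ∈ R i ∩ {x | 0 < (O i).f g x.1}} = ∅ := by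
        ext t
        simp [hf]
      rw [h, measureReal_empty, mul_zero]
      exact le_antisymm ((hO.firm i).f_nonneg g v) (not_lt.mp hf)

open Classical in
theorem IsCoreOutcome.exists_spne (hna : ∀ g, NonAtomic (μw g)) (hO : IsCoreOutcome M r O) :
    ∃ a σ, IsSPNE M μw r a σ ∧ OutcomeAEEq (gameOutcome M μw a σ) O := by
  choose Y hYm hYae hY using fun g => hO.exists_monotone_wages g
  choose R hRm hRd hRf hR using fun g => hO.1.exists_assignment hna g
  -- Cutting down to `Y` makes wages monotone at every point of the offer sets, as an `Announcement`
  -- requires, at the cost of a null set of productivities.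
  let H : Firm → WorkerGroup → Set Worker := fun i g => R g i ∩ {x | x.1 ∈ Y g}
  have hHm : ∀ i g, MeasurableSet (H i g) := fun i g =>
    (hRm g i).inter (measurable_fst (hYm g))
  have hHd : ∀ i g, Disjoint (H i g) (H i.other g) := by
    intro i g
    have h : Disjoint (H .one g) (H .two g) :=
      (hRd g).mono inter_subset_left inter_subset_left
    cases i
    exacts [h, h.symm]
  have hHf : ∀ i g, ∀ x ∈ H i g, 0 < (O i).f g x.1 := fun i g x hx => hRf g i x hx.1
  have hH : ∀ i g, ∀ v ∈ Y g, M.f g v * (μw g).real {t | (v, t) ∈ H i g} = (O i).f g v := by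
    intro i g v hv
    have h : {t | (v, t) ∈ H i g} = {t | (v, t) ∈ R g i} := by
      ext t
      simp [H, hv]
    rw [h, hR]
  let pref : WorkerGroup → Worker → Firm := fun g x => if x ∈ H .two g then .two else .one
  have hpref : ∀ i g, ∀ x ∈ H i g, pref g x = i := by
    intro i g x hx
    cases i
    · exact if_neg fun h => disjoint_left.mp (hHd .one g) hx h
    · exact if_pos hx
  have hmem : ∀ i g, ∀ x ∈ H i g, x ∈ H .one g ∪ H .two g := by
    intro i g x hx
    cases i
    exacts [Or.inl hx, Or.inr hx]
  have hmem' : ∀ g, ∀ x ∈ H .one g ∪ H .two g, ∃ i, x ∈ H i g := by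
    rintro g x (hx | hx)
    exacts [⟨_, hx⟩, ⟨_, hx⟩]
  let W : WorkerGroup → Worker → ℝ := fun g x => (O (pref g x)).w g x.1
  have hW : ∀ i g, ∀ x ∈ H i g, W g x = (O i).w g x.1 := fun i g x hx => by
    simp only [W, hpref i g x hx]
  have hWm : ∀ g, Measurable (W g) := by
    intro g
    have h : W g = fun x => if x ∈ H .two g then (O .two).w g x.1 else (O .one).w g x.1 := by
      ext x
      simp only [W, pref]
      split_ifs <;> rfl
    rw [h]
    exact Measurable.ite (hHm _ g) (((hO.1.firm _).measurable_w g).comp measurable_fst)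
      (((hO.1.firm _).measurable_w g).comp measurable_fst)
  let A : Announcement :=
    { S := fun g => H .one g ∪ H .two g
      w := W
      measurable_S := fun g => (hHm _ g).union (hHm _ g)
      measurable_w := fun g => (hWm g).comp measurable_subtype_coe
      monotone := by
        intro g x hx y hy hle
        obtain ⟨i, hi⟩ := hmem' g x hx
        obtain ⟨j, hj⟩ := hmem' g y hy
        rw [hW i g x hi, hW j g y hj]
        exact hY g x.1 hi.2 y.1 hj.2 hle i j (hHf i g x hi) (hHf j g y hj) }
  have hAw : ∀ i g, ∀ x ∈ H i g, A.w g x = (O i).w g x.1 := hW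
  -- Each firm also offers the core wage to the workers of the other, so that an employer who cut
  -- her wage would lose the worker.
  let a : Firm → Announcement := fun _ => A
  let σ := WorkerStrategies.ofPreference pref
  have hσ : OptimalChoices σ := optimalChoices_ofPreference
  have hhired : ∀ i g, hired a σ i g = H i g := by
    intro i g
    have hsub : ∀ i, H i g ⊆ hired a σ i g := by
      intro i x hx
      have hp := hpref i g x hx
      have h := mem_hired_ofPreference (a := a) (pref := pref) (hmem i g x hx)
        (by
          change 0 ≤ A.w g x
          rw [hAw i g x hx]
          exact (hO.1.firm i).w_nonneg g x.1)
        fun _ => le_rfl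
      rwa [hp] at h
    refine Subset.antisymm (fun x hx => ?_) (hsub i)
    obtain ⟨k, hk⟩ := hmem' g x (mem_of_mem_hired hx)
    have hik : i = k := by
      by_contra hne
      exact disjoint_left.mp (disjoint_hired hne) hx (hsub k hk)
    rwa [hik]
  have hm : ∀ i g, MeasurableSet (hired a σ i g) := fun i g => by
    rw [hhired]
    exact hHm i g
  have hden : ∀ i g, ∀ v ∈ Y g, hiredDensity M μw a σ i g v = (O i).f g v := by
    intro i g v hv
    rw [hiredDensity, hhired]
    exact hH i g v hv
  have hwage : ∀ i g, ∀ v ∈ Y g, paidWage M μw a σ i g v = (O i).w g v := by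
    intro i g v hv
    by_cases hd : 0 < hiredDensity M μw a σ i g v
    · obtain ⟨t, ht⟩ := exists_mem_of_hiredDensity_pos hd
      rw [paidWage_eq hd ht]
      exact hAw i g _ (hhired i g ▸ ht)
    · rw [paidWage_eq_zero hd]
      rw [hden i g v hv] at hd
      exact ((hO.1.firm i).w_eq_zero g v
        (le_antisymm (not_lt.mp hd) ((hO.1.firm i).f_nonneg g v))).symm
  have hae : OutcomeAEEq (gameOutcome M μw a σ) O := fun i g =>
    (hYae g).mono fun v hv => ⟨hden i g v hv, hwage i g v hv⟩
  refine ⟨a, σ, ⟨hσ, fun j a' => ?_⟩, hae⟩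
  have hpay : firmPayoff M μw r a σ j = profit M (O j) := by
    rw [firmPayoff_eq_profit (hm j) (not_violates_of_ae_shift (hO.1.firm j).isMeasurable
      (hO.1.firm j).restriction (hm j) (ε := 0) fun g => ?_)]
    · exact profit_congr M fun g => (hae j g).mono fun v hv => by
        rw [profitDensity, profitDensity, hv.1, hv.2]
    · filter_upwards [hae j g] with v hv hf
      exact ⟨hv.1 ▸ hf, by rw [hv.2, add_zero]⟩
  rw [hpay]
  by_contra! hgain
  have h0 : 0 ≤ firmPayoff M μw r (Function.update a j a') σ j :=
    (hO.profit_nonneg j).trans hgain.le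
  have hself : Function.update a j a' j = a' := Function.update_self _ _ _
  have hother : Function.update a j a' j.other = A :=
    Function.update_of_ne j.other_ne _ _
  set b := Function.update a j a'
  rw [firmPayoff_eq_profit_of_nonneg h0] at hgain
  refine hO.2 ⟨j, gameOutcome M μw b σ j, isFirmOutcome_gameOutcome hσ h0, hgain, fun g => ?_⟩
  filter_upwards [hYae g] with v hv
  have hfeas := hO.1.feasible' j g v
  change (_ ≤ paidWage M μw b σ j g v ∧ _ < paidWage M μw b σ j g v) ∨
    (_ ≤ paidWage M μw b σ j g v ∧ hiredDensity M μw b σ j g v + _ ≤ _) ∨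
    (_ < paidWage M μw b σ j g v ∧ hiredDensity M μw b σ j g v + _ ≤ _) ∨
    (hiredDensity M μw b σ j g v + _ + _ ≤ _)
  by_cases hd : 0 < hiredDensity M μw b σ j g v
  swap
  · refine Or.inr (Or.inr (Or.inr ?_))
    linarith
  have hsum : ∀ K : Set Index, MeasurableSet K →
      Disjoint {t | (v, t) ∈ hired b σ j g} K →
      hiredDensity M μw b σ j g v + M.f g v * (μw g).real K ≤ M.f g v := by
    intro K hK hdisj
    have h1 := measureReal_union (μ := μw g) hdisj hK
    have h2 : (μw g).real ({t | (v, t) ∈ hired b σ j g} ∪ K) ≤ 1 := measureReal_le_one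
    have h3 : hiredDensity M μw b σ j g v
      = M.f g v * (μw g).real {t | (v, t) ∈ hired b σ j g} := rfl
    rw [h3, ← mul_add, ← h1]
    exact mul_le_of_le_one_right (M.f_pos g v).le h2
  have hHv : ∀ i, MeasurableSet {t | (v, t) ∈ H i g} := fun i =>
    measurable_prodMk_left (hHm i g)
  -- Some worker assigned to the rival is hired: alternative (1). The bound on the firm's own core
  -- wage comes from `hY` at `v` itself, by which the rival's wage is at least as high.
  by_cases hk : ∃ t, (v, t) ∈ hired b σ j g ∧ (v, t) ∈ H j.other g
  · obtain ⟨t, ht, htk⟩ := hk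
    have hp := hpref _ g _ htk
    have hwk := hAw _ g _ htk
    have hlt := lt_of_mem_hired_ofPreference (a := b) (pref := pref) (x := (v, t)) (g := g)
    rw [hp, j.other_other, hother, hwk, hself] at hlt
    have hlt' := hlt ht (hmem _ g _ htk) ((hO.1.firm _).w_nonneg g v)
    refine Or.inl ⟨?_, ?_⟩
    · rcases ((hO.1.firm j).f_nonneg g v).eq_or_lt with hf | hf
      · rw [(hO.1.firm j).w_eq_zero g v hf.symm]
        exact hσ.paidWage_nonneg v
      · rw [paidWage_eq hd ht, hself]
        exact (hY g v hv v hv le_rfl _ _ (hHf _ g _ htk) hf).trans hlt'.le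
    · rw [paidWage_eq hd ht, hself]
      exact hlt'
  have hdk : Disjoint {t | (v, t) ∈ hired b σ j g} {t | (v, t) ∈ H j.other g} :=
    disjoint_left.mpr fun t ht htk => hk ⟨t, ht, htk⟩
  -- An own worker still holds the rival's identical offer, so she is paid at least her core wage,
  -- and nobody is taken from the rival: alternative (2). If no own worker is hired either, only the
  -- unemployed are left: alternative (4).
  by_cases hj : ∃ t, (v, t) ∈ hired b σ j g ∧ (v, t) ∈ H j g
  · obtain ⟨t, ht, htj⟩ := hj
    refine Or.inr (Or.inl ⟨?_, ?_⟩)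
    · have h := hσ.le_of_mem (j := j.other) ht (by
        rw [hother]
        exact hmem _ g _ htj)
      rw [hother, hAw _ g _ htj] at h
      rwa [paidWage_eq hd ht]
    · rw [← hH j.other g v hv]
      exact hsum _ (hHv _) hdk
  · refine Or.inr (Or.inr (Or.inr ?_))
    have hdj : Disjoint {t | (v, t) ∈ hired b σ j g} {t | (v, t) ∈ H j g} :=
      disjoint_left.mpr fun t ht htj => hj ⟨t, ht, htj⟩
    have h := hsum _ ((hHv j).union (hHv j.other)) (hdj.union_right hdk)
    have hdv : Disjoint {t | (v, t) ∈ H j g} {t | (v, t) ∈ H j.other g} :=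
      (hHd j g).preimage (Prod.mk v)
    rw [measureReal_union hdv (hHv _), mul_add,
      hH j g v hv, hH j.other g v hv] at h
    linarith

end Game

end LaborMarket

end

theorem mainTheorem12 [MeasurableSpace LaborMarket.Index]
    (M : LaborMarket.Market)
    (μw : LaborMarket.WorkerGroup → MeasureTheory.Measure LaborMarket.Index)
    (hprob : ∀ g, MeasureTheory.IsProbabilityMeasure (μw g))
    (hna : ∀ g, LaborMarket.NonAtomic (μw g))
    (r : LaborMarket.Regime) :
    (∀ (a : LaborMarket.Firm → LaborMarket.Announcement) (σ : LaborMarket.WorkerStrategies),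
      LaborMarket.IsSPNE M μw r a σ →
        LaborMarket.IsCoreOutcome M r (LaborMarket.gameOutcome M μw a σ)) ∧
    (∀ O : LaborMarket.Firm → LaborMarket.FirmOutcome,
      LaborMarket.IsCoreOutcome M r O →
        ∃ (a : LaborMarket.Firm → LaborMarket.Announcement) (σ : LaborMarket.WorkerStrategies),
          LaborMarket.IsSPNE M μw r a σ ∧
            LaborMarket.OutcomeAEEq (LaborMarket.gameOutcome M μw a σ) O) := by
  exact ⟨fun a σ h => h.isCoreOutcome hna, fun O hO => hO.exists_spne hna⟩
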